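/- A Nevanlinna function is a function $m$ holomorphic on $\mathbb C\setminus\mathbb R$ with $m(\bar z)=\overline{m(z)}$ for all $z\in\mathbb C\setminus\mathbb R$ and $\operatorname{Im} m(z)\ge 0$ for $\operatorname{Im} z>0$. It is an inverse Stieltjes function if it extends holomorphically to $\mathbb C\setminus[0,+\infty)$ and the extension takes nonpositive real values on $(-\infty,0)$. Let $\mathcal A_0$ be the class of all Nevanlinna functions $m$ for which there exist $\alpha\in(0,1)$, $C>0$ and a Möbius transformation $\mu(z)=\frac{az+b}{cz+d}$ with $a,b,c,d\in\mathbb R$, $ad-bc\in\{1,-1\}$, such that $\mu\circ m$ is an inverse Stieltjes function and, for every $z\in\mathbb C\setminus\mathbb R$, $$\lim_{r\downarrow 0}\frac{(\mu\circ m)(rz)}{-C(-rz)^{\alpha}}=1 ,$$ where $(\cdot)^\alpha$ is the principal branch of the power. For a Nevanlinna function $m$ let $\mathcal H(m)$ be the reproducing kernel Hilbert space of functions on $\mathbb C\setminus\mathbb R$ with the nonnegative kernel $$K_m(z,w)=\frac{m(z)-\overline{m(w)}}{z-\overline w}\quad (z\ne\overline w),\qquad K_m(z,\overline z)=m'(z),$$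 and let $w_m(y)=1/\operatorname{Im} m(iy)$ for $y>0$. The function $m$ has the $B_0$-property if for every $h\in\mathcal H(m)$ the function $y\mapsto h(iy)$, $0<y<1$, belongs to the weighted space $L^2_{w_m}(0,1)=L^2\bigl((0,1),w_m(y)\,dy\bigr)$, and the operator $\mathcal H(m)\to L^2_{w_m}(0,1)$, $h\mapsto h(i\,\cdot)$, is bounded. Corollary. Every function in $\mathcal A_0$ has the $B_0$-property. -/

import Mathlib

open MeasureTheory Set Filter Topology ComplexConjugate
open scoped NNReal ENNReal

noncomputable section

namespace Nevanlinna

/-- The set of non-real complex numbers, as a type. -/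
abbrev NonReal : Type := {z : ℂ // z.im ≠ 0}

/-- The complex plane cut along the half-line `[0, +∞)`. -/
def cutPlane : Set ℂ := {z : ℂ | ¬ (z.im = 0 ∧ 0 ≤ z.re)}

/-- `m` is a Nevanlinna function: holomorphic on the set of non-real numbers, symmetric with
respect to complex conjugation, with nonnegative imaginary part on the open upper half-plane.
Only the values of `m` at non-real points are used, here and below; the values of a Nevanlinna
function at real points of its domain of holomorphy are those of its holomorphic continuation. -/
structure IsNevanlinna (m : ℂ → ℂ) : Prop where
  holo : DifferentiableOn ℂ m {z : ℂ | z.im ≠ 0}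
  symm : ∀ z : ℂ, z.im ≠ 0 → m (conj z) = conj (m z)
  im_nonneg : ∀ z : ℂ, 0 < z.im → 0 ≤ (m z).im

/-- `m` is an inverse Stieltjes function: a Nevanlinna function whose domain of holomorphy contains
the plane cut along `[0, +∞)` and whose values (that is, those of the holomorphic continuation `g`)
on the negative half-line are real and nonpositive. -/
def IsInverseStieltjes (m : ℂ → ℂ) : Prop :=
  IsNevanlinna m ∧
    ∃ g : ℂ → ℂ, DifferentiableOn ℂ g cutPlane ∧
      (∀ z : ℂ, z.im ≠ 0 → g z = m z) ∧
      ∀ x : ℝ, x < 0 → (g x).im = 0 ∧ (g x).re ≤ 0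

/-- The Möbius transformation `z ↦ (a z + b) / (c z + d)` of the real matrix `!![a, b; c, d]`. -/
def moebius (M : Matrix (Fin 2) (Fin 2) ℝ) (z : ℂ) : ℂ :=
  ((M 0 0 : ℂ) * z + (M 0 1 : ℂ)) / ((M 1 0 : ℂ) * z + (M 1 1 : ℂ))

/-- The asymptotic class `𝒜₀`: Nevanlinna functions `m` for which there are `α ∈ (0, 1)`, `C > 0`
and a Möbius transformation `μ` with a real matrix of determinant `1` or `-1` such that `μ ∘ m` is
an inverse Stieltjes function and, for every non-real `z`,
`(μ ∘ m) (r z) ∼ -C (-r z) ^ α` as `r → 0+` (principal branch of the power). -/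
def AsymptoticClassZero : Set (ℂ → ℂ) :=
  {m | IsNevanlinna m ∧
    ∃ α : ℝ, α ∈ Ioo (0 : ℝ) 1 ∧ ∃ C : ℝ, 0 < C ∧
      ∃ M : Matrix (Fin 2) (Fin 2) ℝ, (M.det = 1 ∨ M.det = -1) ∧
        IsInverseStieltjes (fun z => moebius M (m z)) ∧
        ∀ z : ℂ, z.im ≠ 0 →
          Tendsto
            (fun r : ℝ => moebius M (m ((r : ℂ) * z)) /
              (-(C : ℂ) * (-((r : ℂ) * z)) ^ (α : ℂ)))
            (𝓝[>] (0 : ℝ)) (𝓝 1)}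

/-- The Nevanlinna kernel `K_m(z, w) = (m(z) - conj m(w)) / (z - conj w)` for non-real `z`, `w`; at
the removable singularities `z = conj w` its value is the limit `m'(z)`. -/
def kernelFun (m : ℂ → ℂ) (z w : ℂ) : ℂ :=
  open Classical in
  if z = conj w then deriv m z else (m z - conj (m w)) / (z - conj w)

/-- The Nevanlinna kernel as an operator-valued matrix (with `c : ℂ` read as multiplication by `c`),
the form in which Mathlib's reproducing kernel Hilbert spaces take their kernels. -/
def kernel (m : ℂ → ℂ) : Matrix NonReal NonReal (ℂ →L[ℂ] ℂ) :=
  Matrix.of fun z w => kernelFun m z.1 w.1 • (1 : ℂ →L[ℂ] ℂ)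

/-- The reproducing kernel Hilbert space `ℋ(m)` of functions on the set of non-real numbers, with
the kernel `K_m`. -/
abbrev space (m : ℂ → ℂ) [Fact (kernel m).PosSemidef] : Type :=
  RKHS.OfKernel (kernel m)

/-- The function `y ↦ h (i y)` of the real variable `y ≠ 0` (with the value `0` at `y = 0`). -/
def onImaginaryAxis (h : NonReal → ℂ) (y : ℝ) : ℂ :=
  open Classical in
  if hy : y ≠ 0 then h ⟨(y : ℂ) * Complex.I, by simpa using hy⟩ else 0

/-- The weight `w_m(y) = 1 / Im m(i y)`. -/
def weight (m : ℂ → ℂ) (y : ℝ) : ℝ := 1 / (m ((y : ℂ) * Complex.I)).im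

/-- The measure `w_m(y) dy` on the interval `(0, 1)`. -/
def weightMeasureZero (m : ℂ → ℂ) : Measure ℝ :=
  (volume.restrict (Ioo (0 : ℝ) 1)).withDensity fun y => ENNReal.ofReal (weight m y)

/-- The `B₀`-property: the map `h ↦ (y ↦ h (i y))`, `0 < y < 1`, sends `ℋ(m)` into
`L²((0, 1), w_m(y) dy)` and is a bounded operator between these spaces. That the kernel `K_m` is
nonnegative, so that `ℋ(m)` exists, is part of what is asserted (it holds for every Nevanlinna
function). -/
def HasB0Property (m : ℂ → ℂ) : Prop :=
  ∃ hK : (kernel m).PosSemidef,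
    haveI : Fact (kernel m).PosSemidef := ⟨hK⟩
    ∃ C : ℝ≥0, ∀ h : space m,
      MemLp (onImaginaryAxis h) 2 (weightMeasureZero m) ∧
        eLpNorm (onImaginaryAxis h) 2 (weightMeasureZero m) ≤ (C : ℝ≥0∞) * ‖h‖ₑ

end Nevanlinna

end

/-! Two facts are needed: the kernel of a Nevanlinna function is nonnegative, and evaluation along
the imaginary axis is bounded into the weighted space.

Nonnegativity. On discs exhausting the upper half-plane, Cauchy's formula evaluates the Gram matrix
of explicit vectors in the `L²` space of the circle with weight `Im m ≥ 0`. Their Gram matrices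
converge to `K_m`, and nonnegativity survives the limit (`tendsto_gramKernel`,
`IsNevanlinna.re_sum_kernelFun_nonneg`).

Boundedness. By a `T T*` argument it suffices that the integral operator with kernel `√w_m(y)
√w_m(s) |K_m(iy, is)|` is bounded on `L²(0, 1)`. The modulus of this weighted kernel does not change
when `m` is replaced by `μ ∘ m` with determinant `1`: numerator and weight pick up cancelling powers
of the denominator of `μ` (`moebius_sub_conj_mul`, `moebius_im`). The asymptotics make both `|μ ∘
m|` and `Im (μ ∘ m)` comparable to `y ^ α` at `iy`, so the weighted kernel is dominated by
`homKernel`, which is homogeneous of degree `-1` (`exists_kernelFun_le_homKernel`). The Schur test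
with test function `s ^ (-1/2)` bounds the latter operator because `α < 1`
(`integral_mul_homKernel_le`), and `setIntegral_mul_normSq_inner_le` transfers the bound to the
Hilbert space. -/

noncomputable section

namespace Nevanlinna

/-! ### Cauchy integrals over a circle, with conjugates rewritten holomorphically -/

section Cauchy

section Circle

variable {c : ℂ} {ρ : ℝ} {f : ℂ → ℂ} {U : Set ℂ}

lemma circleMap_sub_ne_zero (hρ : 0 < ρ) {z : ℂ} (hz : z ∈ Metric.ball c ρ) (θ : ℝ) :
    circleMap c ρ θ - z ≠ 0 := by
  intro h
  have h1 := circleMap_mem_sphere c hρ.le θ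
  rw [sub_eq_zero.1 h] at h1
  exact (Metric.mem_ball.1 hz).ne (Metric.mem_sphere.1 h1)

lemma sub_mul_conj_of_mem_sphere {e : ℂ} (he : e ∈ Metric.sphere c ρ) :
    (e - c) * conj (e - c) = (ρ : ℂ) ^ 2 := by
  rw [Complex.mul_conj, Complex.normSq_eq_norm_sq, ← dist_eq_norm, Metric.mem_sphere.1 he]
  push_cast; rfl

/-- Replacing `conj (e - w)` on the circle by a holomorphic expression. -/
lemma sub_mul_conj_sub_of_mem_sphere {e : ℂ} (he : e ∈ Metric.sphere c ρ) (w : ℂ) :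
    (e - c) * conj (e - w) = (ρ : ℂ) ^ 2 - (e - c) * conj (w - c) := by
  rw [← sub_mul_conj_of_mem_sphere he]
  simp only [map_sub]; ring

lemma sq_sub_mul_conj_ne_zero (hρ : 0 < ρ) {z w : ℂ} (hz : z ∈ Metric.closedBall c ρ)
    (hw : w ∈ Metric.ball c ρ) : (ρ : ℂ) ^ 2 - (z - c) * conj (w - c) ≠ 0 := by
  intro h
  have h1 : ‖(z - c) * conj (w - c)‖ = ρ ^ 2 := by
    rw [← sub_eq_zero.1 h]; simp
  rw [norm_mul, RCLike.norm_conj, ← dist_eq_norm, ← dist_eq_norm] at h1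
  have h2 := Metric.mem_closedBall.1 hz
  have h3 := Metric.mem_ball.1 hw
  nlinarith [dist_nonneg (x := w) (y := c), dist_nonneg (x := z) (y := c)]

/-- On the circle `de = i (e - c) dθ`, so a factor `e - c` turns an angular integral into a contour
integral. -/
lemma integral_sub_center_mul_circleMap (f : ℂ → ℂ) :
    ∫ θ in (0 : ℝ)..2 * Real.pi, (circleMap c ρ θ - c) * f (circleMap c ρ θ) =
      -Complex.I * ∮ e in C(c, ρ), f e := by
  rw [circleIntegral, ← intervalIntegral.integral_const_mul]
  congr 1; ext θ
  rw [deriv_circleMap, circleMap_sub_center, smul_eq_mul]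
  linear_combination (circleMap 0 ρ θ * f (circleMap c ρ θ)) * Complex.I_sq

/-- On the circle the integrand equals `(e - c)` times a Cauchy kernel at `z` times `f e / (ρ² - (e
- c) conj (w - c))`. The last quotient is holomorphic in the disc, its pole being the reflection of
`w` in the circle, so Cauchy's formula at `z` applies. -/
lemma integral_div_sub_mul_conj_sub (hρ : 0 < ρ) (hf : DiffContOnCl ℂ f (Metric.ball c ρ))
    {z w : ℂ} (hz : z ∈ Metric.ball c ρ) (hw : w ∈ Metric.ball c ρ) :
    ∫ θ in (0 : ℝ)..2 * Real.pi,
        f (circleMap c ρ θ) / ((circleMap c ρ θ - z) * conj (circleMap c ρ θ - w)) =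
      2 * Real.pi * f z / ((ρ : ℂ) ^ 2 - (z - c) * conj (w - c)) := by
  have hg : DiffContOnCl ℂ (fun e => ((ρ : ℂ) ^ 2 - (e - c) * conj (w - c))⁻¹ • f e)
      (Metric.ball c ρ) := by
    refine DiffContOnCl.smul (DiffContOnCl.inv ?_ ?_) hf
    · exact Differentiable.diffContOnCl (by fun_prop)
    · intro e he
      rw [closure_ball _ hρ.ne'] at he
      exact sq_sub_mul_conj_ne_zero hρ he hw
  have := hg.circleIntegral_sub_inv_smul hz
  have h2 := integral_sub_center_mul_circleMap (c := c) (ρ := ρ)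
    (fun e => (e - z)⁻¹ • ((ρ : ℂ) ^ 2 - (e - c) * conj (w - c))⁻¹ • f e)
  rw [this] at h2
  calc _ = _ := by
        refine intervalIntegral.integral_congr fun θ _ => ?_
        have he := circleMap_mem_sphere c hρ.le θ
        have h1 := sub_mul_conj_sub_of_mem_sphere he w
        have h3 := circleMap_sub_ne_zero hρ hz θ
        have h4 := circleMap_sub_ne_zero hρ (Metric.mem_ball_self hρ (x := c)) θ
        have h5 : conj (circleMap c ρ θ - w) ≠ 0 :=
          (map_ne_zero _).2 (circleMap_sub_ne_zero hρ hw θ)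
        simp only [smul_eq_mul]
        rw [← h1]
        field_simp
    _ = _ := h2
    _ = _ := by
        simp only [smul_eq_mul]
        rw [div_eq_mul_inv]
        linear_combination (-2 * Real.pi * f z * ((ρ : ℂ) ^ 2 - (z - c) * conj (w - c))⁻¹) *
          Complex.I_sq

/-- After conjugation both poles are reflected out of the disc and the integrand is holomorphic up
to the factor `e - c`; Cauchy's theorem gives zero. -/
lemma integral_conj_mul_sub_center_div (hρ : 0 < ρ) (hf : DiffContOnCl ℂ f (Metric.ball c ρ))
    {z w : ℂ} (hz : z ∈ Metric.ball c ρ) (hw : w ∈ Metric.ball c ρ) :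
    ∫ θ in (0 : ℝ)..2 * Real.pi, conj (f (circleMap c ρ θ)) * (circleMap c ρ θ - c) /
        ((circleMap c ρ θ - z) * (circleMap c ρ θ - w)) = 0 := by
  have hd : ∀ v ∈ Metric.ball c ρ,
      DiffContOnCl ℂ (fun e => ((ρ : ℂ) ^ 2 - (e - c) * conj (v - c))⁻¹) (Metric.ball c ρ) := by
    intro v hv
    refine DiffContOnCl.inv (Differentiable.diffContOnCl (by fun_prop)) fun e he => ?_
    rw [closure_ball _ hρ.ne'] at he
    exact sq_sub_mul_conj_ne_zero hρ he hv
  have := ((hd z hz).smul ((hd w hw).smul hf)).circleIntegral_eq_zero hρ.le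
  have h2 := integral_sub_center_mul_circleMap (c := c) (ρ := ρ)
    (fun e => ((ρ : ℂ) ^ 2 - (e - c) * conj (z - c))⁻¹ •
      ((ρ : ℂ) ^ 2 - (e - c) * conj (w - c))⁻¹ • f e)
  erw [this] at h2
  rw [mul_zero] at h2
  rw [← map_eq_zero (starRingEnd ℂ), ← intervalIntegral.intervalIntegral_conj,
    ← mul_zero ((ρ : ℂ) ^ 2), ← h2, ← intervalIntegral.integral_const_mul]
  refine intervalIntegral.integral_congr fun θ _ => ?_
  have he := circleMap_mem_sphere c hρ.le θ
  have h4 := circleMap_sub_ne_zero hρ (Metric.mem_ball_self hρ (x := c)) θ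
  have h5 : conj (circleMap c ρ θ - w) ≠ 0 :=
    (map_ne_zero _).2 (circleMap_sub_ne_zero hρ hw θ)
  have h6 : conj (circleMap c ρ θ - z) ≠ 0 :=
    (map_ne_zero _).2 (circleMap_sub_ne_zero hρ hz θ)
  simp only [smul_eq_mul]
  rw [← sub_mul_conj_sub_of_mem_sphere he w, ← sub_mul_conj_sub_of_mem_sphere he z,
    ← sub_mul_conj_of_mem_sphere he, map_div₀, map_mul, map_mul, Complex.conj_conj]
  field_simp

lemma integral_mul_sub_center_div (hU : IsOpen U) (hρ : 0 < ρ) (hf : DifferentiableOn ℂ f U)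
    (hc : Metric.closedBall c ρ ⊆ U) {z w : ℂ} (hz : z ∈ Metric.ball c ρ)
    (hw : w ∈ Metric.ball c ρ) :
    ∫ θ in (0 : ℝ)..2 * Real.pi, f (circleMap c ρ θ) * (circleMap c ρ θ - c) /
        ((circleMap c ρ θ - z) * (circleMap c ρ θ - w)) = 2 * Real.pi * dslope f w z := by
  have h2 := integral_sub_center_mul_circleMap (c := c) (ρ := ρ)
    (fun e => f e / ((e - z) * (e - w)))
  have h3 : ∮ e in C(c, ρ), f e / ((e - z) * (e - w)) =
      2 * Real.pi * Complex.I * dslope f w z := by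
    rcases eq_or_ne z w with rfl | hzw
    · have := Complex.two_pi_I_inv_smul_circleIntegral_sub_sq_inv_smul_of_differentiable hU hc hf hz
      rw [dslope_same, ← this, smul_eq_mul, mul_inv_cancel_left₀ Complex.two_pi_I_ne_zero]
      congr 1; ext e
      rw [smul_eq_mul, div_eq_inv_mul, pow_two]
    · have hd := hf.diffContOnCl_ball hc
      have h1 := hd.circleIntegral_sub_inv_smul hz
      have h1' := hd.circleIntegral_sub_inv_smul hw
      have hi : ∀ v ∈ Metric.ball c ρ, CircleIntegrable (fun e => (e - v)⁻¹ • f e) c ρ := by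
        intro v hv
        refine ContinuousOn.circleIntegrable hρ.le ?_
        refine ContinuousOn.smul ((continuousOn_id.sub continuousOn_const).inv₀ ?_)
          (hf.continuousOn.mono (Metric.sphere_subset_closedBall.trans hc))
        intro e he h
        rw [show e = v from sub_eq_zero.1 h] at he
        exact (Metric.mem_ball.1 hv).ne (Metric.mem_sphere.1 he)
      have hzw' : z - w ≠ 0 := sub_ne_zero.2 hzw
      -- Partial fractions reduce the two simple poles to two Cauchy formulas.
      have h5 : ∮ e in C(c, ρ), f e / ((e - z) * (e - w)) =
          ∮ e in C(c, ρ), (z - w)⁻¹ * ((e - z)⁻¹ • f e - (e - w)⁻¹ • f e) := by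
        refine circleIntegral.integral_congr hρ.le fun e he => ?_
        have he1 : e - z ≠ 0 := by
          intro h
          rw [sub_eq_zero.1 h] at he
          exact (Metric.mem_ball.1 hz).ne (Metric.mem_sphere.1 he)
        have he2 : e - w ≠ 0 := by
          intro h
          rw [sub_eq_zero.1 h] at he
          exact (Metric.mem_ball.1 hw).ne (Metric.mem_sphere.1 he)
        simp only [smul_eq_mul]
        field_simp
        ring
      rw [h5, circleIntegral.integral_const_mul, circleIntegral.integral_sub (hi z hz) (hi w hw),
        h1, h1', dslope_of_ne _ hzw, slope_def_field]
      simp only [smul_eq_mul]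
      field_simp
  rw [h3] at h2
  calc _ = _ := by
        refine intervalIntegral.integral_congr fun θ _ => ?_
        ring
    _ = _ := h2
    _ = _ := by linear_combination (-2 * Real.pi * dslope f w z) * Complex.I_sq

end Circle

end Cauchy

/-! ### Gram matrices in the weighted `L²` space of a circle -/

section Gram

/-- The Gram vectors on the circle with center `c` and radius `ρ` whose integrals against
`Im f` approximate the Nevanlinna kernel of `f`. -/
def gramVector (c : ℂ) (ρ : ℝ) (z e : ℂ) : ℂ :=
  if 0 < z.im then 1 / (e - z) else conj (Complex.I * (e - c) / (ρ * (e - conj z)))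

/-- The Gram matrix of the vectors `gramVector c ρ z` in `L²(Im f)` on the circle. -/
def gramKernel (f : ℂ → ℂ) (c : ℂ) (ρ : ℝ) (z w : ℂ) : ℂ :=
  (ρ / Real.pi : ℝ) * ∫ θ in (0 : ℝ)..2 * Real.pi,
    gramVector c ρ z (circleMap c ρ θ) * conj (gramVector c ρ w (circleMap c ρ θ)) *
      ((f (circleMap c ρ θ)).im : ℂ)

/-- The representative of a non-real number in the upper half-plane up to conjugation. -/
def upper (z : ℂ) : ℂ := if 0 < z.im then z else conj z

variable {c : ℂ} {ρ : ℝ} {f : ℂ → ℂ}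

lemma continuous_gramVector (hρ : 0 < ρ) {z : ℂ} (hz : upper z ∈ Metric.ball c ρ) :
    Continuous fun θ : ℝ => gramVector c ρ z (circleMap c ρ θ) := by
  have hρ' : (ρ : ℂ) ≠ 0 := by exact_mod_cast hρ.ne'
  have hc := continuous_circleMap c ρ
  unfold gramVector
  unfold upper at hz
  split_ifs at hz ⊢ with h
  · exact continuous_const.div (hc.sub continuous_const) fun θ => circleMap_sub_ne_zero hρ hz θ
  · refine Complex.continuous_conj.comp (Continuous.div ?_ ?_ ?_)
    · exact continuous_const.mul (hc.sub continuous_const)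
    · exact continuous_const.mul (hc.sub continuous_const)
    · exact fun θ => mul_ne_zero hρ' (circleMap_sub_ne_zero hρ hz θ)

/-- The quadratic form is a positive multiple of the integral of `|∑ v i * gramVector (p i)|² * Im
f`. -/
lemma re_sum_gramKernel_nonneg (hρ : 0 < ρ) (hf : ContinuousOn f (Metric.sphere c ρ))
    (him : ∀ e ∈ Metric.sphere c ρ, 0 ≤ (f e).im) {ι : Type*} (s : Finset ι) (p : ι → ℂ)
    (hs : ∀ i ∈ s, upper (p i) ∈ Metric.ball c ρ) (v : ι → ℂ) :
    0 ≤ (∑ i ∈ s, ∑ j ∈ s, v i * conj (v j) * gramKernel f c ρ (p i) (p j)).re := by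
  have hF : Continuous fun θ : ℝ => ((f (circleMap c ρ θ)).im : ℂ) := by
    refine Complex.continuous_ofReal.comp (Complex.continuous_im.comp ?_)
    exact hf.comp_continuous (continuous_circleMap c ρ) fun θ => circleMap_mem_sphere c hρ.le θ
  have key : ∑ i ∈ s, ∑ j ∈ s, v i * conj (v j) * gramKernel f c ρ (p i) (p j) =
      ((ρ / Real.pi * ∫ θ in (0 : ℝ)..2 * Real.pi,
        Complex.normSq (∑ i ∈ s, v i * gramVector c ρ (p i) (circleMap c ρ θ)) *
          (f (circleMap c ρ θ)).im : ℝ) : ℂ) := by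
    have hint : ∀ i ∈ s, ∀ j ∈ s, Continuous fun θ : ℝ => v i * conj (v j) *
        (gramVector c ρ (p i) (circleMap c ρ θ) *
          conj (gramVector c ρ (p j) (circleMap c ρ θ)) * ((f (circleMap c ρ θ)).im : ℂ)) :=
      fun i hi j hj => continuous_const.mul (((continuous_gramVector hρ (hs i hi)).mul
        (Complex.continuous_conj.comp (continuous_gramVector hρ (hs j hj)))).mul hF)
    rw [Complex.ofReal_mul, ← intervalIntegral.integral_ofReal]
    calc _ = ∑ i ∈ s, ∑ j ∈ s, ((ρ / Real.pi : ℝ) : ℂ) * ∫ θ in (0 : ℝ)..2 * Real.pi,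
          v i * conj (v j) * (gramVector c ρ (p i) (circleMap c ρ θ) *
          conj (gramVector c ρ (p j) (circleMap c ρ θ)) * ((f (circleMap c ρ θ)).im : ℂ)) := by
          refine Finset.sum_congr rfl fun i _ => Finset.sum_congr rfl fun j _ => ?_
          rw [intervalIntegral.integral_const_mul, gramKernel]
          ring
      _ = ((ρ / Real.pi : ℝ) : ℂ) * ∫ θ in (0 : ℝ)..2 * Real.pi, ∑ i ∈ s, ∑ j ∈ s,
          v i * conj (v j) * (gramVector c ρ (p i) (circleMap c ρ θ) *
          conj (gramVector c ρ (p j) (circleMap c ρ θ)) * ((f (circleMap c ρ θ)).im : ℂ)) := by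
          rw [intervalIntegral.integral_finsetSum, Finset.mul_sum]
          · refine Finset.sum_congr rfl fun i hi => ?_
            rw [intervalIntegral.integral_finsetSum, Finset.mul_sum]
            exact fun j hj => (hint i hi j hj).intervalIntegrable _ _
          · exact fun i hi => (continuous_finsetSum _ fun j hj =>
              hint i hi j hj).intervalIntegrable _ _
      _ = _ := by
          congr 1
          refine intervalIntegral.integral_congr fun θ _ => ?_
          simp only [Complex.ofReal_mul, ← Complex.mul_conj, map_sum, map_mul]
          rw [Finset.sum_mul_sum, Finset.sum_mul]
          refine Finset.sum_congr rfl fun i _ => ?_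
          rw [Finset.sum_mul]
          refine Finset.sum_congr rfl fun j _ => ?_
          ring
  rw [key, Complex.ofReal_re]
  refine mul_nonneg (by positivity) ?_
  refine intervalIntegral.integral_nonneg (by positivity) fun θ _ => ?_
  exact mul_nonneg (Complex.normSq_nonneg _) (him _ (circleMap_mem_sphere c hρ.le θ))

lemma gramKernel_conj_symm (f : ℂ → ℂ) (c : ℂ) (ρ : ℝ) (z w : ℂ) :
    conj (gramKernel f c ρ w z) = gramKernel f c ρ z w := by
  unfold gramKernel
  rw [map_mul, Complex.conj_ofReal, ← intervalIntegral.intervalIntegral_conj]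
  congr 1
  refine intervalIntegral.integral_congr fun θ _ => ?_
  simp only [map_mul, Complex.conj_conj, Complex.conj_ofReal]
  ring

lemma intervalIntegral_mul_im {a b : ℝ} {g : ℝ → ℂ} {h : ℝ → ℂ} (hg : Continuous g)
    (hh : Continuous h) :
    ∫ θ in a..b, g θ * ((h θ).im : ℂ) =
      ((∫ θ in a..b, g θ * h θ) - ∫ θ in a..b, g θ * conj (h θ)) / (2 * Complex.I) := by
  have h1 : Continuous fun θ => g θ * h θ := hg.mul hh
  have h2 : Continuous fun θ => g θ * conj (h θ) := hg.mul (Complex.continuous_conj.comp hh)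
  rw [← intervalIntegral.integral_sub (h1.intervalIntegrable _ _) (h2.intervalIntegrable _ _),
    ← intervalIntegral.integral_div]
  refine intervalIntegral.integral_congr fun θ _ => ?_
  simp only [Complex.im_eq_sub_conj]
  ring

/-- With `Im f = (f - conj f) / 2i`, the `f` part yields the value at `z` and the `conj f` part, by
conjugation, the value at `w`. The denominator is the disc analogue of `z - conj w`. -/
lemma gramKernel_upper_upper (hρ : 0 < ρ) (hf : DiffContOnCl ℂ f (Metric.ball c ρ)) {z w : ℂ}
    (hz : z ∈ Metric.ball c ρ) (hw : w ∈ Metric.ball c ρ) (hz0 : 0 < z.im) (hw0 : 0 < w.im) :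
    gramKernel f c ρ z w =
      ρ * (f z - conj (f w)) / (Complex.I * ((ρ : ℂ) ^ 2 - (z - c) * conj (w - c))) := by
  have hfc : Continuous fun θ => f (circleMap c ρ θ) :=
    hf.continuousOn_ball.comp_continuous (continuous_circleMap c ρ) fun θ =>
      Metric.sphere_subset_closedBall (circleMap_mem_sphere c hρ.le θ)
  have hz' : upper z ∈ Metric.ball c ρ := by rwa [upper, if_pos hz0]
  have hw' : upper w ∈ Metric.ball c ρ := by rwa [upper, if_pos hw0]
  have hπ : (Real.pi : ℂ) ≠ 0 := by exact_mod_cast Real.pi_ne_zero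
  have hne := sq_sub_mul_conj_ne_zero hρ (Metric.ball_subset_closedBall hz) hw
  have hφ : Continuous fun θ : ℝ => gramVector c ρ z (circleMap c ρ θ) *
      conj (gramVector c ρ w (circleMap c ρ θ)) := (continuous_gramVector hρ hz').mul
    (Complex.continuous_conj.comp (continuous_gramVector hρ hw'))
  unfold gramKernel
  rw [intervalIntegral_mul_im hφ hfc]
  have h1 := integral_div_sub_mul_conj_sub hρ hf hz hw
  have h2 := congrArg conj (integral_div_sub_mul_conj_sub hρ hf hw hz)
  rw [← intervalIntegral.intervalIntegral_conj] at h2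
  have e1 : ∫ θ in (0 : ℝ)..2 * Real.pi, gramVector c ρ z (circleMap c ρ θ) *
      conj (gramVector c ρ w (circleMap c ρ θ)) * f (circleMap c ρ θ) =
      2 * Real.pi * f z / ((ρ : ℂ) ^ 2 - (z - c) * conj (w - c)) := by
    rw [← h1]
    refine intervalIntegral.integral_congr fun θ _ => ?_
    simp only [gramVector, if_pos hz0, if_pos hw0, map_inv₀, one_mul, div_eq_mul_inv, mul_inv]
    ring
  have e2 : ∫ θ in (0 : ℝ)..2 * Real.pi, gramVector c ρ z (circleMap c ρ θ) *
      conj (gramVector c ρ w (circleMap c ρ θ)) * conj (f (circleMap c ρ θ)) =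
      2 * Real.pi * conj (f w) / ((ρ : ℂ) ^ 2 - (z - c) * conj (w - c)) := by
    calc _ = _ := by
          refine intervalIntegral.integral_congr fun θ _ => ?_
          simp only [gramVector, if_pos hz0, if_pos hw0, map_inv₀, map_mul, Complex.conj_conj,
            one_mul, div_eq_mul_inv, mul_inv]
          ring
      _ = _ := h2
      _ = _ := by
          simp only [map_div₀, map_mul, map_sub, map_pow, Complex.conj_ofReal, Complex.conj_conj,
            map_ofNat]
          ring
  rw [e1, e2]
  push_cast
  field_simp

/-- The factor `i (e - c) / ρ` in the vector of a lower point, unimodular on the circle, is chosen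
for this case: it kills the `conj f` part and turns the `f` part into a contour integral with poles
`z` and `conj w`. The difference quotient comes out exactly, for every disc. -/
lemma gramKernel_upper_lower {U : Set ℂ} (hU : IsOpen U) (hρ : 0 < ρ) (hf : DifferentiableOn ℂ f U)
    (hc : Metric.closedBall c ρ ⊆ U) {z w : ℂ} (hz : z ∈ Metric.ball c ρ)
    (hw : conj w ∈ Metric.ball c ρ) (hz0 : 0 < z.im) (hw0 : w.im < 0) :
    gramKernel f c ρ z w = dslope f (conj w) z := by
  have hd := hf.diffContOnCl_ball hc
  have hfc : Continuous fun θ => f (circleMap c ρ θ) :=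
    hd.continuousOn_ball.comp_continuous (continuous_circleMap c ρ) fun θ =>
      Metric.sphere_subset_closedBall (circleMap_mem_sphere c hρ.le θ)
  have hz' : upper z ∈ Metric.ball c ρ := by rwa [upper, if_pos hz0]
  have hw' : upper w ∈ Metric.ball c ρ := by rwa [upper, if_neg hw0.not_gt]
  have hπ : (Real.pi : ℂ) ≠ 0 := by exact_mod_cast Real.pi_ne_zero
  have hρ' : (ρ : ℂ) ≠ 0 := by exact_mod_cast hρ.ne'
  have hφ : Continuous fun θ : ℝ => gramVector c ρ z (circleMap c ρ θ) *
      conj (gramVector c ρ w (circleMap c ρ θ)) := (continuous_gramVector hρ hz').mul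
    (Complex.continuous_conj.comp (continuous_gramVector hρ hw'))
  unfold gramKernel
  rw [intervalIntegral_mul_im hφ hfc]
  have h1 := integral_mul_sub_center_div hU hρ hf hc hz hw
  have h2 := integral_conj_mul_sub_center_div hρ hd hz hw
  have e1 : ∫ θ in (0 : ℝ)..2 * Real.pi, gramVector c ρ z (circleMap c ρ θ) *
      conj (gramVector c ρ w (circleMap c ρ θ)) * f (circleMap c ρ θ) =
      Complex.I / ρ * (2 * Real.pi * dslope f (conj w) z) := by
    rw [← h1, ← intervalIntegral.integral_const_mul]
    refine intervalIntegral.integral_congr fun θ _ => ?_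
    simp only [gramVector, if_pos hz0, if_neg hw0.not_gt, Complex.conj_conj, div_eq_mul_inv,
      mul_inv]
    ring
  have e2 : ∫ θ in (0 : ℝ)..2 * Real.pi, gramVector c ρ z (circleMap c ρ θ) *
      conj (gramVector c ρ w (circleMap c ρ θ)) * conj (f (circleMap c ρ θ)) = 0 := by
    rw [← mul_zero (Complex.I / ρ), ← h2, ← intervalIntegral.integral_const_mul]
    refine intervalIntegral.integral_congr fun θ _ => ?_
    simp only [gramVector, if_pos hz0, if_neg hw0.not_gt, Complex.conj_conj, div_eq_mul_inv,
      mul_inv]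
    ring
  rw [e1, e2]
  push_cast
  field_simp
  simp

/-- The two unimodular factors cancel because `(e - c) conj (e - c) = ρ²`. -/
lemma gramKernel_lower_lower (hρ : 0 < ρ) {z w : ℂ} (hz0 : z.im < 0) (hw0 : w.im < 0) :
    gramKernel f c ρ z w = gramKernel f c ρ (conj w) (conj z) := by
  have hρ' : (ρ : ℂ) ≠ 0 := by exact_mod_cast hρ.ne'
  unfold gramKernel
  congr 1
  refine intervalIntegral.integral_congr fun θ _ => ?_
  have he := sub_mul_conj_of_mem_sphere (circleMap_mem_sphere c hρ.le θ)
  have hz1 : 0 < (conj z).im := by simpa using hz0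
  have hw1 : 0 < (conj w).im := by simpa using hw0
  simp only [gramVector, if_pos hz1, if_pos hw1, if_neg hw0.not_gt, if_neg hz0.not_gt,
    Complex.conj_conj, map_div₀, map_mul, Complex.conj_I, Complex.conj_ofReal, map_one, map_neg, neg_neg]
  congr 1
  calc _ = -Complex.I ^ 2 * ((circleMap c ρ θ - c) * conj (circleMap c ρ θ - c)) / ρ ^ 2 *
        (1 / (circleMap c ρ θ - conj w) * (1 / conj (circleMap c ρ θ - conj z))) := by
        field_simp
    _ = _ := by
        rw [he, Complex.I_sq]
        field_simp

end Gram

/-! ### Exhaustion of the half-plane and nonnegativity of the Nevanlinna kernel -/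

section Positivity

lemma closedBall_subset_upperHalfPlane {R ρ : ℝ} (h : ρ < R) :
    Metric.closedBall ((R : ℂ) * Complex.I) ρ ⊆ {z : ℂ | 0 < z.im} := by
  intro z hz
  have h1 := (Complex.abs_im_le_norm (z - R * Complex.I)).trans
    (by simpa [dist_eq_norm] using hz)
  simp only [Complex.sub_im, Complex.mul_im, Complex.ofReal_re, Complex.I_im, mul_one,
    Complex.ofReal_im, Complex.I_re, mul_zero, add_zero] at h1
  have := (abs_le.1 h1).1
  show 0 < z.im
  linarith

/-- Radius `R - R⁻¹` keeps the closed disc inside the open half-plane. Since `|z - iR|² = |z|² - 2 R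
Im z + R²`, the point is captured as soon as `2 R Im z > |z|² + 2`. -/
lemma eventually_mem_ball {z : ℂ} (hz : 0 < z.im) :
    ∀ᶠ R : ℝ in atTop, z ∈ Metric.ball ((R : ℂ) * Complex.I) (R - R⁻¹) := by
  filter_upwards [eventually_gt_atTop 1,
    eventually_gt_atTop ((Complex.normSq z + 2) / (2 * z.im))] with R h1 h2
  have h0 : 0 < R := by linarith
  have h3 : R⁻¹ < 1 := inv_lt_one_of_one_lt₀ h1
  have h4 : R * R⁻¹ = 1 := mul_inv_cancel₀ h0.ne'
  rw [div_lt_iff₀ (by positivity)] at h2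
  rw [Metric.mem_ball, dist_eq_norm]
  refine lt_of_pow_lt_pow_left₀ 2 (by linarith) ?_
  rw [← Complex.normSq_eq_norm_sq]
  simp only [Complex.normSq_apply, Complex.sub_re, Complex.sub_im, Complex.mul_im, Complex.mul_re,
    Complex.ofReal_re, Complex.I_im, mul_one, Complex.ofReal_im, Complex.I_re, mul_zero,
    add_zero, sub_zero] at h2 ⊢
  nlinarith [sq_nonneg R⁻¹]

lemma isOpen_upperHalfPlane : IsOpen {z : ℂ | 0 < z.im} :=
  isOpen_lt continuous_const Complex.continuous_im

variable {m : ℂ → ℂ}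

lemma IsNevanlinna.differentiableOn_upper (hm : IsNevanlinna m) :
    DifferentiableOn ℂ m {z : ℂ | 0 < z.im} :=
  hm.holo.mono fun _ hz => ne_of_gt hz

lemma IsNevanlinna.deriv_conj (hm : IsNevanlinna m) {z : ℂ} (hz : z.im ≠ 0) :
    deriv m (conj z) = conj (deriv m z) := by
  have hopen : IsOpen {z : ℂ | z.im ≠ 0} := isOpen_ne_fun Complex.continuous_im continuous_const
  have hd : HasDerivAt m (deriv m z) z :=
    (hm.holo.differentiableAt (hopen.mem_nhds hz)).hasDerivAt
  refine (hd.conj_conj.congr_of_eventuallyEq ?_).deriv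
  have hz' : (conj z).im ≠ 0 := by simpa using hz
  filter_upwards [hopen.mem_nhds hz'] with u hu
  simp only [Function.comp_apply]
  rw [hm.symm u hu, Complex.conj_conj]

lemma IsNevanlinna.conj_kernelFun (hm : IsNevanlinna m) {z w : ℂ} (hz : z.im ≠ 0) :
    conj (kernelFun m z w) = kernelFun m w z := by
  unfold kernelFun
  split_ifs with h1 h2 h2
  · rw [h2, hm.deriv_conj hz]
  · exact absurd (by rw [h1, Complex.conj_conj]) h2
  · exact absurd (by rw [h2, Complex.conj_conj]) h1
  · simp only [map_div₀, map_sub, Complex.conj_conj]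
    rw [← neg_sub (m w), ← neg_sub w, neg_div_neg_eq]

lemma IsNevanlinna.kernelFun_conj_conj (hm : IsNevanlinna m) {z w : ℂ} (hz : z.im ≠ 0)
    (hw : w.im ≠ 0) (hzw : z ≠ conj w) : kernelFun m (conj w) (conj z) = kernelFun m z w := by
  unfold kernelFun
  rw [if_neg hzw, if_neg (by rw [Complex.conj_conj]; exact hzw.symm), hm.symm w hw, hm.symm z hz,
    Complex.conj_conj, Complex.conj_conj, ← neg_sub (m z), ← neg_sub z, neg_div_neg_eq]

lemma IsNevanlinna.dslope_eq_kernelFun (hm : IsNevanlinna m) {z w : ℂ} (hw : w.im ≠ 0) :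
    dslope m (conj w) z = kernelFun m z w := by
  unfold kernelFun
  split_ifs with h
  · rw [h, dslope_same]
  · rw [dslope_of_ne _ h, slope_def_field, hm.symm w hw]

lemma tendsto_gramKernel_upper_upper (hm : IsNevanlinna m) {z w : ℂ} (hz : 0 < z.im)
    (hw : 0 < w.im) :
    Tendsto (fun R : ℝ => gramKernel m (R * Complex.I) (R - R⁻¹) z w) atTop
      (𝓝 (kernelFun m z w)) := by
  have hne : z ≠ conj w := by
    intro h
    have := congrArg Complex.im h
    rw [Complex.conj_im] at this
    linarith
  have hne' : z - conj w ≠ 0 := sub_ne_zero.2 hne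
  -- The Gram entry in the variable `t = R⁻¹`, with numerator and denominator divided by `R`; it is
  -- continuous at `t = 0`, where it equals the kernel.
  set F : ℝ → ℂ := fun t => (1 - (t : ℂ) ^ 2) * (m z - conj (m w)) /
    (Complex.I * ((t : ℂ) * (-2 + (t : ℂ) ^ 2) - t * z * conj w - Complex.I * (z - conj w)))
    with hF
  have hF0 : F 0 = kernelFun m z w := by
    simp only [hF, kernelFun, if_neg hne, Complex.ofReal_zero]
    congr 1
    · ring
    · linear_combination (-(z - conj w)) * Complex.I_sq
  have hcont : ContinuousAt F 0 := by
    refine ContinuousAt.div (by fun_prop) (by fun_prop) ?_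
    simp [hne', Complex.I_ne_zero]
  have hlim : Tendsto (fun R : ℝ => F R⁻¹) atTop (𝓝 (kernelFun m z w)) := by
    rw [← hF0]
    exact hcont.tendsto.comp tendsto_inv_atTop_zero
  refine hlim.congr' ?_
  filter_upwards [eventually_mem_ball hz, eventually_mem_ball hw, eventually_gt_atTop 1]
    with R h1 h2 hR
  have h0 : 0 < R := by linarith
  have h3 : R⁻¹ < 1 := inv_lt_one_of_one_lt₀ hR
  have hR0 : (R : ℂ) ≠ 0 := by exact_mod_cast h0.ne'
  have hd := hm.differentiableOn_upper.diffContOnCl_ball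
    (closedBall_subset_upperHalfPlane (show R - R⁻¹ < R by linarith [inv_pos.2 h0]))
  rw [gramKernel_upper_upper (by linarith) hd h1 h2 hz hw]
  simp only [hF]
  have hRi : (R : ℂ) * (R : ℂ)⁻¹ = 1 := mul_inv_cancel₀ hR0
  rw [← mul_div_mul_left _ (Complex.I * ((R⁻¹ : ℝ) * (-2 + ((R⁻¹ : ℝ) : ℂ) ^ 2) -
    (R⁻¹ : ℝ) * z * conj w - Complex.I * (z - conj w))) hR0]
  simp only [map_sub, map_mul, Complex.conj_ofReal, Complex.conj_I]
  push_cast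
  congr 1
  · linear_combination (-(R : ℂ)⁻¹ * (m z - conj (m w))) * hRi
  · linear_combination (Complex.I * (-2 + (R : ℂ)⁻¹ ^ 2 - z * conj w) + 2 * Complex.I) * hRi -
      Complex.I * (R : ℂ) ^ 2 * Complex.I_sq

lemma tendsto_gramKernel (hm : IsNevanlinna m) {z w : ℂ} (hz : z.im ≠ 0) (hw : w.im ≠ 0) :
    Tendsto (fun R : ℝ => gramKernel m (R * Complex.I) (R - R⁻¹) z w) atTop
      (𝓝 (kernelFun m z w)) := by
  have hUL : ∀ {z w : ℂ}, 0 < z.im → w.im < 0 →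
      Tendsto (fun R : ℝ => gramKernel m (R * Complex.I) (R - R⁻¹) z w) atTop
        (𝓝 (kernelFun m z w)) := by
    intro z w hz hw
    have hw' : 0 < (conj w).im := by simpa using hw
    refine tendsto_const_nhds.congr' ?_
    filter_upwards [eventually_mem_ball hz, eventually_mem_ball hw', eventually_gt_atTop 1]
      with R h1 h2 hR
    have h0 : 0 < R := by linarith
    have h3 : R⁻¹ < 1 := inv_lt_one_of_one_lt₀ hR
    rw [gramKernel_upper_lower isOpen_upperHalfPlane (by linarith) hm.differentiableOn_upper
      (closedBall_subset_upperHalfPlane (by linarith [inv_pos.2 h0])) h1 h2 hz hw,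
      hm.dslope_eq_kernelFun hw.ne]
  rcases lt_or_gt_of_ne hz with hz0 | hz0 <;> rcases lt_or_gt_of_ne hw with hw0 | hw0
  · have hne : z ≠ conj w := by
      intro h
      have := congrArg Complex.im h
      rw [Complex.conj_im] at this
      linarith
    rw [← hm.kernelFun_conj_conj hz hw hne]
    refine (tendsto_gramKernel_upper_upper hm (by simpa using hw0) (by simpa using hz0)).congr' ?_
    filter_upwards [eventually_gt_atTop 1] with R hR
    rw [gramKernel_lower_lower (by linarith [inv_lt_one_of_one_lt₀ hR]) hz0 hw0]
  -- Hermitian symmetry reduces this to the mixed case already settled.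
  · rw [← hm.conj_kernelFun hw]
    simp_rw [← gramKernel_conj_symm m _ _ z w]
    exact (Complex.continuous_conj.tendsto _).comp (hUL hw0 hz0)
  · exact hUL hz0 hw0
  · exact tendsto_gramKernel_upper_upper hm hz0 hw0

lemma upper_im_pos {z : ℂ} (hz : z.im ≠ 0) : 0 < (upper z).im := by
  unfold upper
  split_ifs with h
  · exact h
  · simpa using lt_of_le_of_ne (not_lt.1 h) hz

lemma IsNevanlinna.re_sum_kernelFun_nonneg (hm : IsNevanlinna m) (s : Finset NonReal)
    (v : NonReal → ℂ) :
    0 ≤ (∑ x ∈ s, ∑ y ∈ s, v x * conj (v y) * kernelFun m x y).re := by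
  have hlim : Tendsto (fun R : ℝ => (∑ x ∈ s, ∑ y ∈ s, v x * conj (v y) *
      gramKernel m (R * Complex.I) (R - R⁻¹) x y).re) atTop
      (𝓝 (∑ x ∈ s, ∑ y ∈ s, v x * conj (v y) * kernelFun m x y).re) := by
    refine (Complex.continuous_re.tendsto _).comp ?_
    exact tendsto_finsetSum _ fun x _ => tendsto_finsetSum _ fun y _ =>
      (tendsto_gramKernel hm x.2 y.2).const_mul _
  refine ge_of_tendsto hlim ?_
  have hball : ∀ᶠ R : ℝ in atTop, ∀ x ∈ s,
      upper x ∈ Metric.ball ((R : ℂ) * Complex.I) (R - R⁻¹) :=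
    (Filter.eventually_all_finset s).2 fun x _ => eventually_mem_ball (upper_im_pos x.2)
  filter_upwards [hball, eventually_gt_atTop 1] with R h1 hR
  have h0 : 0 < R := by linarith
  have hsub : Metric.sphere ((R : ℂ) * Complex.I) (R - R⁻¹) ⊆ {z : ℂ | 0 < z.im} :=
    Metric.sphere_subset_closedBall.trans
      (closedBall_subset_upperHalfPlane (by linarith [inv_pos.2 h0]))
  exact re_sum_gramKernel_nonneg (by linarith [inv_lt_one_of_one_lt₀ hR])
    (hm.differentiableOn_upper.continuousOn.mono hsub)
    (fun e he => hm.im_nonneg e (hsub he)) s (fun x : NonReal => (x : ℂ)) h1 v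

/-- The kernel of a Nevanlinna function is nonnegative. -/
theorem IsNevanlinna.posSemidef_kernel (hm : IsNevanlinna m) : (kernel m).PosSemidef := by
  have htfae := (RKHS.posSemidef_tfae (K := kernel m)).out 0 2
  refine htfae.2 ⟨?_, fun v => ?_⟩
  · ext z w
    rw [Matrix.conjTranspose_apply]
    simp [kernel, ← hm.conj_kernelFun w.2]
  · have := hm.re_sum_kernelFun_nonneg v.support fun x => conj (v x)
    convert! this using 1
    simp only [Finsupp.sum, kernel, Matrix.of_apply, RCLike.re_eq_complex_re]
    congr 1
    refine Finset.sum_congr rfl fun x _ => Finset.sum_congr rfl fun y _ => ?_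
    rw [← hm.conj_kernelFun y.2]
    simp only [smul_apply, one_apply_eq_self, smul_eq_mul, RCLike.inner_apply,
      map_mul, Complex.conj_conj]
    ring

end Positivity

/-! ### Möbius normalization and bounds on the imaginary axis -/

section Asymptotics

variable {M : Matrix (Fin 2) (Fin 2) ℝ} {m : ℂ → ℂ}

/-- The denominator of the Möbius transformation of `M`. -/
def moebiusDenom (M : Matrix (Fin 2) (Fin 2) ℝ) (z : ℂ) : ℂ := (M 1 0 : ℂ) * z + (M 1 1 : ℂ)

/-- With `moebius_im`, this makes the modulus of the weighted kernel Möbius invariant: the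
denominators gained by the numerator are those lost by the weights. -/
lemma moebius_sub_conj_mul (hdet : M.det = 1) {z w : ℂ} (hz : moebiusDenom M z ≠ 0)
    (hw : moebiusDenom M w ≠ 0) :
    (moebius M z - conj (moebius M w)) * (moebiusDenom M z * conj (moebiusDenom M w)) =
      z - conj w := by
  have hdet' : (M 0 0 : ℂ) * M 1 1 - M 0 1 * M 1 0 = 1 := by
    rw [Matrix.det_fin_two] at hdet; exact_mod_cast hdet
  have h1 : moebius M z = ((M 0 0 : ℂ) * z + (M 0 1 : ℂ)) / moebiusDenom M z := rfl
  have h2 : moebius M w = ((M 0 0 : ℂ) * w + (M 0 1 : ℂ)) / moebiusDenom M w := rfl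
  have hw' : conj (moebiusDenom M w) ≠ 0 := (map_ne_zero _).2 hw
  rw [h1, h2, map_div₀, sub_mul, ← mul_assoc, div_mul_cancel₀ _ hz,
    mul_comm (moebiusDenom M z), ← mul_assoc, div_mul_cancel₀ _ hw']
  simp only [moebiusDenom, map_add, map_mul, Complex.conj_ofReal]
  linear_combination (z - conj w) * hdet'

lemma moebius_im (M : Matrix (Fin 2) (Fin 2) ℝ) (z : ℂ) :
    (moebius M z).im = M.det * z.im / Complex.normSq (moebiusDenom M z) := by
  rw [moebius, Complex.div_im, ← sub_div, Matrix.det_fin_two]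
  simp only [moebiusDenom]
  congr 1
  simp only [Complex.add_re, Complex.add_im, Complex.mul_re, Complex.mul_im, Complex.ofReal_re,
    Complex.ofReal_im]
  ring

lemma moebiusDenom_ne_zero (hdet : M.det = 1) {z : ℂ} (hz : z.im ≠ 0) :
    moebiusDenom M z ≠ 0 := by
  intro h
  have him := congrArg Complex.im h
  have hre := congrArg Complex.re h
  simp only [moebiusDenom, Complex.add_im, Complex.mul_im, Complex.ofReal_re, Complex.ofReal_im,
    Complex.add_re, Complex.mul_re, Complex.zero_im, Complex.zero_re, zero_mul, add_zero, sub_zero,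
    mul_eq_zero, hz, or_false] at him hre
  rw [him, zero_mul, zero_add] at hre
  rw [Matrix.det_fin_two, him, hre] at hdet
  simp at hdet

lemma convex_upperHalfPlane : Convex ℝ {z : ℂ | 0 < z.im} := convex_halfSpace_im_gt 0

/-- A Nevanlinna function that is nonreal somewhere in the upper half-plane maps the upper
half-plane into itself. -/
lemma IsNevanlinna.im_pos (hm : IsNevanlinna m) {z₀ : ℂ} (hz₀ : 0 < z₀.im) (h₀ : 0 < (m z₀).im)
    {z : ℂ} (hz : 0 < z.im) : 0 < (m z).im := by
  rcases (hm.differentiableOn_upper.analyticOnNhd isOpen_upperHalfPlane).is_constant_or_isOpen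
    convex_upperHalfPlane.isPreconnected with ⟨w, hw⟩ | h
  -- Open mapping alternative: a constant `m` keeps the value at `z₀`; otherwise the image is an
  -- open subset of the closed half-plane.
  · rw [hw z hz, ← hw z₀ hz₀]; exact h₀
  · have hopen := h _ subset_rfl isOpen_upperHalfPlane
    have hsub : m '' {z : ℂ | 0 < z.im} ⊆ interior {z : ℂ | 0 ≤ z.im} := by
      refine hopen.subset_interior_iff.2 ?_
      rintro _ ⟨u, hu, rfl⟩
      exact hm.im_nonneg u hu
    rw [Complex.interior_setOfPred_le_im] at hsub
    exact hsub (mem_image_of_mem m hz)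

lemma neg_mul_I_cpow {r : ℝ} (hr : 0 < r) (α : ℝ) :
    (-((r : ℂ) * Complex.I)) ^ (α : ℂ) =
      ((r ^ α : ℝ) : ℂ) * Complex.exp (-((Real.pi * α / 2 : ℝ) : ℂ) * Complex.I) := by
  have hI : -Complex.I ≠ 0 := neg_ne_zero.2 Complex.I_ne_zero
  have hr' : (r : ℂ) ≠ 0 := by exact_mod_cast hr.ne'
  rw [show -((r : ℂ) * Complex.I) = r * -Complex.I by ring,
    Complex.cpow_def_of_ne_zero (mul_ne_zero hr' hI), Complex.log_ofReal_mul hr hI,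
    Complex.log_neg_I, Real.rpow_def_of_pos hr, Complex.ofReal_exp, ← Complex.exp_add]
  congr 1
  push_cast
  ring

lemma bddAbove_of_tendsto_nhdsGT {g : ℝ → ℝ} (hg : ContinuousOn g (Ioc 0 1)) {L : ℝ}
    (hL : Tendsto g (𝓝[>] 0) (𝓝 L)) : ∃ A : ℝ, 0 < A ∧ ∀ y ∈ Ioc (0 : ℝ) 1, g y ≤ A := by
  have h1 : ∀ᶠ y in 𝓝[>] (0 : ℝ), g y < L + 1 := hL.eventually_lt_const (by linarith)
  obtain ⟨δ, hδ, h2⟩ := mem_nhdsGT_iff_exists_Ioo_subset.1 h1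
  have hδ0 : 0 < δ := hδ
  obtain ⟨B, hB⟩ := (isCompact_Icc.bddAbove_image
    (hg.mono fun y hy => ⟨hδ0.trans_le hy.1, hy.2⟩ : ContinuousOn g (Icc δ 1)))
  refine ⟨max (max (L + 1) B) 1, by positivity, fun y hy => ?_⟩
  rcases lt_or_ge y δ with h | h
  · exact (h2 ⟨hy.1, h⟩).le.trans ((le_max_left _ _).trans (le_max_left _ _))
  · exact (hB (mem_image_of_mem g ⟨h, hy.2⟩)).trans ((le_max_right _ _).trans (le_max_left _ _))

/-- The homogeneous kernel that majorizes the weighted Nevanlinna kernel on the imaginary axis. -/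
def homKernel (α y s : ℝ) : ℝ := (y ^ α + s ^ α) / ((y + s) * (y ^ (α / 2) * s ^ (α / 2)))

lemma kernelFun_imaginary (m : ℂ → ℂ) {y s : ℝ} (hy : 0 < y) (hs : 0 < s) :
    kernelFun m (y * Complex.I) (s * Complex.I) =
      (m (y * Complex.I) - conj (m (s * Complex.I))) / (((y + s : ℝ) : ℂ) * Complex.I) := by
  have h1 : conj ((s : ℂ) * Complex.I) = -(s * Complex.I) := by simp
  rw [kernelFun, if_neg, h1]
  · congr 1; push_cast; ring
  · rw [h1]
    intro h
    have := congrArg Complex.im h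
    simp at this
    linarith

lemma mul_I_im_pos {y : ℝ} (hy : 0 < y) : 0 < ((y : ℂ) * Complex.I).im := by simpa using hy

lemma IsNevanlinna.continuousOn_imaginary (hm : IsNevanlinna m) :
    ContinuousOn (fun y : ℝ => m (y * Complex.I)) (Ioi 0) :=
  hm.differentiableOn_upper.continuousOn.comp (by fun_prop) fun _ hy => mul_I_im_pos hy

/-- The bounds on the imaginary axis that follow from the asymptotics at `0`. -/
lemma exists_bounds_of_mem_asymptoticClassZero (hm : m ∈ AsymptoticClassZero) :
    (∀ z : ℂ, 0 < z.im → 0 < (m z).im) ∧ ∃ α ∈ Ioo (0 : ℝ) 1,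
      ∃ M : Matrix (Fin 2) (Fin 2) ℝ, M.det = 1 ∧ ∃ A : ℝ, 0 < A ∧ ∃ B : ℝ, 0 < B ∧
        ∀ y ∈ Ioc (0 : ℝ) 1, ‖moebius M (m (y * Complex.I))‖ ≤ A * y ^ α ∧
          y ^ α ≤ B * (moebius M (m (y * Complex.I))).im := by
  obtain ⟨hN, α, hα, C, hC, M, hdet, -, hlim⟩ := hm
  -- The limit of `(μ ∘ m)(iy) / y ^ α`, from the asymptotics at `z = i` and `log (-i) = -iπ/2`. Its
  -- imaginary part `C sin (πα/2)` is positive because `0 < α < 1`.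
  set κ : ℂ := -(C : ℂ) * Complex.exp (-((Real.pi * α / 2 : ℝ) : ℂ) * Complex.I) with hκ
  have hκim : 0 < κ.im := by
    have h1 : κ.im = C * Real.sin (Real.pi * α / 2) := by
      rw [hκ, ← Complex.ofReal_neg, ← Complex.ofReal_neg, Complex.im_ofReal_mul,
        Complex.exp_ofReal_mul_I_im, Real.sin_neg]
      ring
    rw [h1]
    refine mul_pos hC (Real.sin_pos_of_pos_of_lt_pi ?_ ?_)
    · have := hα.1; positivity
    · nlinarith [hα.2, Real.pi_pos]
  have hκ0 : κ ≠ 0 := by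
    intro h; rw [h] at hκim; simp at hκim
  set q : ℝ → ℂ := fun y => moebius M (m (y * Complex.I)) / ((y ^ α : ℝ) : ℂ) with hq
  have hqlim : Tendsto q (𝓝[>] 0) (𝓝 κ) := by
    have h1 := (hlim Complex.I (by simp)).mul_const κ
    rw [one_mul] at h1
    refine h1.congr' ?_
    filter_upwards [self_mem_nhdsWithin] with r hr
    have hr0 : 0 < r := hr
    have hr' : ((r ^ α : ℝ) : ℂ) ≠ 0 := by exact_mod_cast (Real.rpow_pos_of_pos hr0 α).ne'
    have hD : -(C : ℂ) * (-((r : ℂ) * Complex.I)) ^ (α : ℂ) = ((r ^ α : ℝ) : ℂ) * κ := by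
      rw [neg_mul_I_cpow hr0, hκ]; ring
    rw [hD, hq]
    field_simp
  have hqim : Tendsto (fun y => (q y).im) (𝓝[>] 0) (𝓝 κ.im) :=
    (Complex.continuous_im.tendsto _).comp hqlim
  have him : ∀ y : ℝ, (q y).im = (moebius M (m (y * Complex.I))).im / y ^ α := fun y => by
    rw [hq, Complex.div_ofReal_im]
  -- Near `0` the imaginary part of `μ ∘ m` is positive while that of `m` is nonnegative, which
  -- excludes determinant `-1` and makes `m` nonreal at some point.
  have hdet1 : M.det = 1 ∧ ∀ z : ℂ, 0 < z.im → 0 < (m z).im := by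
    obtain ⟨y, hy, hy0⟩ := ((hqim.eventually_const_lt hκim).and self_mem_nhdsWithin).exists
    have hy0 : 0 < y := hy0
    have hpos : 0 < (moebius M (m (y * Complex.I))).im := by
      rw [him] at hy
      exact (div_pos_iff_of_pos_right (Real.rpow_pos_of_pos hy0 α)).1 hy
    have hnn := hN.im_nonneg _ (mul_I_im_pos hy0)
    rw [moebius_im] at hpos
    have h2 : 0 < M.det * (m (y * Complex.I)).im := by
      by_contra h
      exact absurd hpos (not_lt.2 (div_nonpos_of_nonpos_of_nonneg (not_lt.1 h)
        (Complex.normSq_nonneg _)))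
    have hd : M.det = 1 := hdet.resolve_right fun h => by rw [h] at h2; linarith
    refine ⟨hd, fun z hz => hN.im_pos (mul_I_im_pos hy0) ?_ hz⟩
    rwa [hd, one_mul] at h2
  obtain ⟨hd, hmpos⟩ := hdet1
  refine ⟨hmpos, α, hα, M, hd, ?_⟩
  have hden : ∀ y : ℝ, 0 < y → moebiusDenom M (m (y * Complex.I)) ≠ 0 := fun y hy =>
    moebiusDenom_ne_zero hd (hmpos _ (mul_I_im_pos hy)).ne'
  have hqpos : ∀ y : ℝ, 0 < y → 0 < (q y).im := fun y hy => by
    rw [him, moebius_im, hd, one_mul]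
    exact div_pos (div_pos (hmpos _ (mul_I_im_pos hy)) (Complex.normSq_pos.2 (hden y hy)))
      (Real.rpow_pos_of_pos hy α)
  have hqc : ContinuousOn q (Ioc 0 1) := by
    have hmc : ContinuousOn (fun y : ℝ => m (y * Complex.I)) (Ioc 0 1) :=
      hN.continuousOn_imaginary.mono Ioc_subset_Ioi_self
    refine ContinuousOn.div (ContinuousOn.div ?_ ?_ fun y hy => hden y hy.1) ?_ fun y hy => ?_
    · exact (continuousOn_const.mul hmc).add continuousOn_const
    · exact (continuousOn_const.mul hmc).add continuousOn_const
    · exact Complex.continuous_ofReal.comp_continuousOn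
        (continuousOn_id.rpow_const fun y hy => Or.inl (ne_of_gt hy.1))
    · exact_mod_cast (Real.rpow_pos_of_pos hy.1 α).ne'
  -- `A` bounds `|q|` and `B` bounds `1 / Im q`; both functions are continuous on `(0, 1]` with
  -- finite limits at `0`.
  obtain ⟨A, hA, hA'⟩ := bddAbove_of_tendsto_nhdsGT hqc.norm hqlim.norm
  obtain ⟨B, hB, hB'⟩ := bddAbove_of_tendsto_nhdsGT
    ((Complex.continuous_im.comp_continuousOn hqc).inv₀ fun y hy => (hqpos y hy.1).ne')
    (hqim.inv₀ hκim.ne')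
  refine ⟨A, hA, B, hB, fun y hy => ⟨?_, ?_⟩⟩
  · have h1 := hA' y hy
    have hp := Real.rpow_pos_of_pos hy.1 α
    rw [hq] at h1
    simp only [norm_div, Complex.norm_real, Real.norm_eq_abs, abs_of_pos hp] at h1
    exact (div_le_iff₀ hp).1 h1
  · have h1 : (q y).im⁻¹ ≤ B := hB' y hy
    have hp := Real.rpow_pos_of_pos hy.1 α
    rw [inv_le_iff_one_le_mul₀ (hqpos y hy.1), him, mul_div_assoc', le_div_iff₀ hp, one_mul] at h1
    exact h1

/-- The weighted kernel of a function of the class `𝒜₀` is dominated by a homogeneous kernel. -/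
theorem exists_kernelFun_le_homKernel (hm : m ∈ AsymptoticClassZero) :
    ∃ α ∈ Ioo (0 : ℝ) 1, ∃ B : ℝ, 0 < B ∧ ∀ y ∈ Ioc (0 : ℝ) 1, ∀ s ∈ Ioc (0 : ℝ) 1,
      √(weight m y) * √(weight m s) * ‖kernelFun m (y * Complex.I) (s * Complex.I)‖ ≤
        B * homKernel α y s := by
  obtain ⟨hmpos, α, hα, M, hd, A, hA, B, hB, hbd⟩ := exists_bounds_of_mem_asymptoticClassZero hm
  refine ⟨α, hα, A * B, mul_pos hA hB, fun y hy s hs => ?_⟩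
  have hmy := hmpos _ (mul_I_im_pos hy.1)
  have hms := hmpos _ (mul_I_im_pos hs.1)
  have hdy := moebiusDenom_ne_zero hd hmy.ne'
  have hds := moebiusDenom_ne_zero hd hms.ne'
  -- The left side equals `1 / √(Im (μ ∘ m)(it))`, so the lower bound on that imaginary part
  -- applies.
  have hw : ∀ t ∈ Ioc (0 : ℝ) 1, √(weight m t) * ‖moebiusDenom M (m (t * Complex.I))‖ ≤
      √B / t ^ (α / 2) := by
    intro t ht
    have hmt := hmpos _ (mul_I_im_pos ht.1)
    have hdt := moebiusDenom_ne_zero hd hmt.ne'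
    have hn := Complex.normSq_pos.2 hdt
    have h1 := (hbd t ht).2
    have hp := Real.rpow_pos_of_pos ht.1 α
    rw [moebius_im, hd, one_mul] at h1
    have h2 : t ^ (α / 2) = √(t ^ α) := by
      rw [Real.sqrt_eq_rpow, ← Real.rpow_mul ht.1.le]; congr 1; ring
    rw [h2, ← Real.sqrt_div hB.le, ← Real.sqrt_sq (norm_nonneg (moebiusDenom M _)),
      ← Real.sqrt_mul (by unfold weight; positivity), ← Complex.normSq_eq_norm_sq]
    refine Real.sqrt_le_sqrt ?_
    rw [weight, le_div_iff₀ hp, one_div_mul_eq_div, div_mul_eq_mul_div, div_le_iff₀ hmt]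
    rw [mul_div_assoc', le_div_iff₀ hn] at h1
    linarith
  have hnum : ‖m (y * Complex.I) - conj (m (s * Complex.I))‖ ≤ A * (y ^ α + s ^ α) *
      (‖moebiusDenom M (m (y * Complex.I))‖ * ‖moebiusDenom M (m (s * Complex.I))‖) := by
    rw [← moebius_sub_conj_mul hd hdy hds, norm_mul, norm_mul, RCLike.norm_conj]
    refine mul_le_mul_of_nonneg_right ?_ (by positivity)
    calc _ ≤ ‖moebius M (m (y * Complex.I))‖ + ‖conj (moebius M (m (s * Complex.I)))‖ :=
          norm_sub_le _ _
      _ ≤ A * y ^ α + A * s ^ α := by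
          rw [RCLike.norm_conj]; exact add_le_add (hbd y hy).1 (hbd s hs).1
      _ = _ := by ring
  have hys : 0 < y + s := add_pos hy.1 hs.1
  have hyα := Real.rpow_pos_of_pos hy.1 α
  have hsα := Real.rpow_pos_of_pos hs.1 α
  have hyα2 := Real.rpow_pos_of_pos hy.1 (α / 2)
  have hsα2 := Real.rpow_pos_of_pos hs.1 (α / 2)
  rw [kernelFun_imaginary m hy.1 hs.1, norm_div, norm_mul, Complex.norm_I, mul_one,
    Complex.norm_real, Real.norm_eq_abs, abs_of_pos hys]
  calc _ ≤ √(weight m y) * √(weight m s) * (A * (y ^ α + s ^ α) *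
        (‖moebiusDenom M (m (y * Complex.I))‖ * ‖moebiusDenom M (m (s * Complex.I))‖) /
          (y + s)) := by gcongr
    _ = (√(weight m y) * ‖moebiusDenom M (m (y * Complex.I))‖) *
        (√(weight m s) * ‖moebiusDenom M (m (s * Complex.I))‖) *
          (A * (y ^ α + s ^ α) / (y + s)) := by ring
    _ ≤ (√B / y ^ (α / 2)) * (√B / s ^ (α / 2)) * (A * (y ^ α + s ^ α) / (y + s)) := by
        gcongr
        · exact hw y hy
        · exact hw s hs
    _ = _ := by
        rw [homKernel]
        field_simp
        rw [Real.sq_sqrt hB.le]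

end Asymptotics

/-! ### Schur test for a kernel homogeneous of degree `-1` -/

section Schur

variable {α δ : ℝ}

lemma homKernel_comm (α y s : ℝ) : homKernel α y s = homKernel α s y := by
  unfold homKernel; ring

lemma homKernel_nonneg {y s : ℝ} (hy : 0 ≤ y) (hs : 0 ≤ s) : 0 ≤ homKernel α y s := by
  unfold homKernel; positivity

lemma continuousOn_homKernel (α : ℝ) :
    ContinuousOn (fun q : ℝ × ℝ => homKernel α q.1 q.2) (Ioi 0 ×ˢ Ioi 0) := by
  have h1 : ∀ β : ℝ, ContinuousOn (fun q : ℝ × ℝ => q.1 ^ β) (Ioi 0 ×ˢ Ioi 0) := fun β =>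
    continuousOn_fst.rpow_const fun q hq => Or.inl (ne_of_gt hq.1)
  have h2 : ∀ β : ℝ, ContinuousOn (fun q : ℝ × ℝ => q.2 ^ β) (Ioi 0 ×ˢ Ioi 0) := fun β =>
    continuousOn_snd.rpow_const fun q hq => Or.inl (ne_of_gt hq.2)
  refine ((h1 α).add (h2 α)).div
    ((continuousOn_fst.add continuousOn_snd).mul ((h1 _).mul (h2 _))) fun q hq => ?_
  have hq1 : 0 < q.1 := hq.1
  have hq2 : 0 < q.2 := hq.2
  positivity

/-- The larger variable `y` dominates both sums in `homKernel`. The resulting power of `s` exceeds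
`-1` exactly when `α < 1`, which gives integrability at `0`. -/
lemma homKernel_mul_sqrt_le_of_le (hα : 0 ≤ α) {y s : ℝ} (hs : 0 < s) (hsy : s ≤ y) :
    homKernel α y s * √(y / s) ≤ 2 * y ^ (-((1 - α) / 2)) * s ^ ((1 - α) / 2 - 1) := by
  have hy : 0 < y := hs.trans_le hsy
  have h1 : s ^ α ≤ y ^ α := Real.rpow_le_rpow hs.le hsy hα
  have h2 : homKernel α y s ≤ 2 * y ^ α / (y * (y ^ (α / 2) * s ^ (α / 2))) := by
    unfold homKernel
    gcongr <;> linarith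
  refine (mul_le_mul_of_nonneg_right h2 (Real.sqrt_nonneg _)).trans (le_of_eq ?_)
  rw [Real.sqrt_eq_rpow, Real.div_rpow hy.le hs.le, div_mul_div_comm,
    show -((1 - α) / 2) = α + 1 / 2 - (1 + α / 2) by ring,
    show (1 - α) / 2 - 1 = -(α / 2 + 1 / 2) by ring, Real.rpow_sub hy, Real.rpow_add hy,
    Real.rpow_add hy, Real.rpow_neg hs.le, Real.rpow_add hs, Real.rpow_one]
  field_simp

/-- Here `s` is the larger variable, and its exponent lies below `-1` when `α < 1`, so the integral
from `y` to `1` is bounded uniformly after the factor in `y`. -/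
lemma homKernel_mul_sqrt_le_of_ge (hα : 0 ≤ α) {y s : ℝ} (hy : 0 < y) (hys : y ≤ s) :
    homKernel α y s * √(y / s) ≤ 2 * y ^ ((1 - α) / 2) * s ^ (-((1 - α) / 2) - 1) := by
  have hs : 0 < s := hy.trans_le hys
  have h1 : y ^ α ≤ s ^ α := Real.rpow_le_rpow hy.le hys hα
  have h2 : homKernel α y s ≤ 2 * s ^ α / (s * (y ^ (α / 2) * s ^ (α / 2))) := by
    unfold homKernel
    gcongr <;> linarith
  refine (mul_le_mul_of_nonneg_right h2 (Real.sqrt_nonneg _)).trans (le_of_eq ?_)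
  rw [Real.sqrt_eq_rpow, Real.div_rpow hy.le hs.le, div_mul_div_comm,
    show (1 - α) / 2 = 1 / 2 - α / 2 by ring,
    show -(1 / 2 - α / 2) - 1 = α - (1 + α / 2 + 1 / 2) by ring, Real.rpow_sub hy,
    Real.rpow_sub hs, Real.rpow_add hs, Real.rpow_add hs, Real.rpow_one]
  field_simp

lemma continuousOn_sqrt_div :
    ContinuousOn (fun q : ℝ × ℝ => √(q.1 / q.2)) (Ioi 0 ×ˢ Ioi 0) :=
  (continuousOn_fst.div continuousOn_snd fun _ hq => ne_of_gt hq.2).sqrt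

/-- With `p = (1 - α) / 2`, each of the ranges `s ≤ y` and `s ≥ y` contributes at most `2 / p`. The
bound depends on neither `y` nor `δ`. -/
lemma integral_homKernel_mul_sqrt_le (hα : α ∈ Ioo (0 : ℝ) 1) (hδ : 0 < δ) {y : ℝ}
    (hy : y ∈ Icc δ 1) :
    ∫ s in Icc δ 1, homKernel α y s * √(y / s) ≤ 8 / (1 - α) := by
  have hy0 : 0 < y := hδ.trans_le hy.1
  set p := (1 - α) / 2 with hp
  have hp0 : 0 < p := by have := hα.2; rw [hp]; linarith
  have hF : ContinuousOn (fun s => homKernel α y s * √(y / s)) (Ioi 0) :=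
    ((continuousOn_homKernel α).mul continuousOn_sqrt_div).comp
      (continuousOn_const.prodMk continuousOn_id) fun s hs => ⟨hy0, hs⟩
  have hi : ∀ {a b : ℝ} {g : ℝ → ℝ}, 0 < a → a ≤ b → ContinuousOn g (Ioi 0) →
      IntervalIntegrable g volume a b := fun ha hab hg =>
    (hg.mono fun s hs => lt_of_lt_of_le ha (by rw [uIcc_of_le hab] at hs; exact hs.1)
      ).intervalIntegrable
  have hpow : ∀ k β : ℝ, ContinuousOn (fun s : ℝ => k * s ^ β) (Ioi 0) := fun k β =>
    continuousOn_const.mul (continuousOn_id.rpow_const fun s hs => Or.inl (ne_of_gt hs))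
  rw [integral_Icc_eq_integral_Ioc, ← intervalIntegral.integral_of_le (hy.1.trans hy.2),
    ← intervalIntegral.integral_add_adjacent_intervals (hi hδ hy.1 hF) (hi hy0 hy.2 hF)]
  have e1 : ∫ s in δ..y, homKernel α y s * √(y / s) ≤ 2 / p := by
    calc _ ≤ ∫ s in δ..y, 2 * y ^ (-p) * s ^ (p - 1) :=
          intervalIntegral.integral_mono_on hy.1 (hi hδ hy.1 hF) (hi hδ hy.1 (hpow _ _))
            fun s hs => homKernel_mul_sqrt_le_of_le hα.1.le (hδ.trans_le hs.1) hs.2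
      _ = 2 * y ^ (-p) * ((y ^ p - δ ^ p) / p) := by
          rw [intervalIntegral.integral_const_mul, integral_rpow (Or.inl (by linarith)),
            sub_add_cancel]
      _ ≤ 2 * y ^ (-p) * (y ^ p / p) := by
          have := Real.rpow_pos_of_pos hδ p
          gcongr
          linarith
      _ = 2 / p := by
          have := Real.rpow_pos_of_pos hy0 p
          rw [Real.rpow_neg hy0.le]
          field_simp
  have e2 : ∫ s in y..1, homKernel α y s * √(y / s) ≤ 2 / p := by
    calc _ ≤ ∫ s in y..1, 2 * y ^ p * s ^ (-p - 1) :=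
          intervalIntegral.integral_mono_on hy.2 (hi hy0 hy.2 hF) (hi hy0 hy.2 (hpow _ _))
            fun s hs => homKernel_mul_sqrt_le_of_ge hα.1.le hy0 hs.1
      _ = 2 * y ^ p * ((1 - y ^ (-p)) / (-p)) := by
          rw [intervalIntegral.integral_const_mul, integral_rpow (Or.inr ⟨by linarith, ?_⟩),
            sub_add_cancel, Real.one_rpow]
          rw [uIcc_of_le hy.2]
          exact fun h => absurd h.1 (not_le.2 hy0)
      _ = 2 * y ^ p * ((y ^ (-p) - 1) / p) := by
          rw [div_neg, ← neg_div, neg_sub]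
      _ ≤ 2 * y ^ p * (y ^ (-p) / p) := by
          gcongr
          linarith
      _ = 2 / p := by
          have := Real.rpow_pos_of_pos hy0 p
          rw [Real.rpow_neg hy0.le]
          field_simp
  calc _ ≤ 2 / p + 2 / p := add_le_add e1 e2
    _ = 8 / (1 - α) := by
        have : 1 - α ≠ 0 := by linarith [hα.2]
        rw [hp]; field_simp; norm_num

lemma restrict_prod_restrict (s : Set ℝ) :
    ((volume : Measure ℝ).restrict s).prod ((volume : Measure ℝ).restrict s) =
      (volume : Measure (ℝ × ℝ)).restrict (s ×ˢ s) := Measure.prod_restrict s s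

/-- The Schur test for the homogeneous kernel. -/
theorem integral_mul_homKernel_le (hα : α ∈ Ioo (0 : ℝ) 1) (hδ : 0 < δ) {a : ℝ → ℝ}
    (ha : ContinuousOn a (Icc δ 1)) :
    ∫ q in Icc δ 1 ×ˢ Icc δ 1, a q.1 * a q.2 * homKernel α q.1 q.2 ≤
      8 / (1 - α) * ∫ y in Icc δ 1, a y ^ 2 := by
  have hsub : (Icc δ 1 ×ˢ Icc δ 1 : Set (ℝ × ℝ)) ⊆ Ioi 0 ×ˢ Ioi 0 :=
    prod_mono (fun y hy => hδ.trans_le hy.1) (fun y hy => hδ.trans_le hy.1)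
  have hcpt : IsCompact (Icc δ 1 ×ˢ Icc δ 1 : Set (ℝ × ℝ)) := isCompact_Icc.prod isCompact_Icc
  have hmeas : MeasurableSet (Icc δ 1 ×ˢ Icc δ 1 : Set (ℝ × ℝ)) :=
    measurableSet_Icc.prod measurableSet_Icc
  have hk := (continuousOn_homKernel α).mono hsub
  have hr := continuousOn_sqrt_div.mono hsub
  have ha1 : ContinuousOn (fun q : ℝ × ℝ => a q.1) (Icc δ 1 ×ˢ Icc δ 1) :=
    ha.comp continuousOn_fst fun q hq => hq.1
  have ha2 : ContinuousOn (fun q : ℝ × ℝ => a q.2) (Icc δ 1 ×ˢ Icc δ 1) :=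
    ha.comp continuousOn_snd fun q hq => hq.2
  -- One half of the Schur splitting; by symmetry of the kernel, the other half is `g` with swapped
  -- variables and has the same integral.
  set g : ℝ × ℝ → ℝ := fun q => a q.1 ^ 2 * (homKernel α q.1 q.2 * √(q.1 / q.2)) with hg
  have hgc : ContinuousOn g (Icc δ 1 ×ˢ Icc δ 1) := (ha1.pow 2).mul (hk.mul hr)
  have hgi : IntegrableOn g (Icc δ 1 ×ˢ Icc δ 1) := hgc.integrableOn_compact hcpt
  have hgsc : ContinuousOn (fun q : ℝ × ℝ => g q.swap) (Icc δ 1 ×ˢ Icc δ 1) :=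
    hgc.comp continuous_swap.continuousOn fun q hq => ⟨hq.2, hq.1⟩
  have hgsi : IntegrableOn (fun q : ℝ × ℝ => g q.swap) (Icc δ 1 ×ˢ Icc δ 1) :=
    hgsc.integrableOn_compact hcpt
  have hX : ∫ q in Icc δ 1 ×ˢ Icc δ 1, g q ≤ 8 / (1 - α) * ∫ y in Icc δ 1, a y ^ 2 := by
    rw [IntegrableOn, ← restrict_prod_restrict] at hgi
    rw [← restrict_prod_restrict, integral_prod _ hgi, ← integral_const_mul]
    refine setIntegral_mono_on hgi.integral_prod_left
      ((continuousOn_const.mul (ha.pow 2)).integrableOn_compact isCompact_Icc)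
      measurableSet_Icc fun y hy => ?_
    simp only [hg]
    rw [integral_const_mul, mul_comm]
    exact mul_le_mul_of_nonneg_right (integral_homKernel_mul_sqrt_le hα hδ hy) (sq_nonneg _)
  have hY : ∫ q in Icc δ 1 ×ˢ Icc δ 1, g q.swap = ∫ q in Icc δ 1 ×ˢ Icc δ 1, g q := by
    rw [← restrict_prod_restrict]
    exact integral_prod_swap g
  calc _ ≤ ∫ q in Icc δ 1 ×ˢ Icc δ 1, (1 / 2) * (g q + g q.swap) := by
        refine setIntegral_mono_on (((ha1.mul ha2).mul hk).integrableOn_compact hcpt)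
          ((hgi.add hgsi).const_mul _) hmeas fun q hq => ?_
        have hq1 : 0 < q.1 := (hsub hq).1
        have hq2 : 0 < q.2 := (hsub hq).2
        have hkq := homKernel_nonneg (α := α) hq1.le hq2.le
        have hst : √(q.1 / q.2) * √(q.2 / q.1) = 1 := by
          rw [← Real.sqrt_mul (by positivity)]
          have : q.1 / q.2 * (q.2 / q.1) = 1 := by field_simp
          rw [this, Real.sqrt_one]
        simp only [hg, Prod.fst_swap, Prod.snd_swap, homKernel_comm α q.2 q.1]
        have hs := Real.sqrt_nonneg (q.1 / q.2)
        have ht := Real.sqrt_nonneg (q.2 / q.1)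
        -- The arithmetic-geometric mean inequality, with weights `√(y/s)` and `√(s/y)` whose
        -- product is `1`.
        have key : a q.1 * a q.2 ≤
            1 / 2 * (a q.1 ^ 2 * √(q.1 / q.2) + a q.2 ^ 2 * √(q.2 / q.1)) := by
          have h1 := Real.mul_self_sqrt hs
          have h2 := Real.mul_self_sqrt ht
          have h3 : √(√(q.1 / q.2)) * √(√(q.2 / q.1)) = 1 := by
            rw [← Real.sqrt_mul hs, hst, Real.sqrt_one]
          have h4 := sq_nonneg (a q.1 * √(√(q.1 / q.2)) - a q.2 * √(√(q.2 / q.1)))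
          have h5 : (a q.1 * √(√(q.1 / q.2)) - a q.2 * √(√(q.2 / q.1))) ^ 2 =
              a q.1 ^ 2 * √(q.1 / q.2) + a q.2 ^ 2 * √(q.2 / q.1) - 2 * (a q.1 * a q.2) := by
            linear_combination a q.1 ^ 2 * h1 + a q.2 ^ 2 * h2 - 2 * a q.1 * a q.2 * h3
          linarith
        calc _ ≤ 1 / 2 * (a q.1 ^ 2 * √(q.1 / q.2) + a q.2 ^ 2 * √(q.2 / q.1)) *
              homKernel α q.1 q.2 := mul_le_mul_of_nonneg_right key hkq
          _ = _ := by ring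
    _ = ∫ q in Icc δ 1 ×ˢ Icc δ 1, g q := by
        rw [integral_const_mul, integral_add hgi hgsi, hY]
        ring
    _ ≤ _ := hX

end Schur

/-! ### From the Schur bound to the bounded embedding -/

section Embedding

section Hilbert

variable {H : Type*} [NormedAddCommGroup H] [InnerProductSpace ℂ H] [CompleteSpace H]
  {α B δ : ℝ} {K : ℝ → H} {w : ℝ → ℝ}

/-- Boundedness of the weighted analysis operator of a continuous family of vectors whose weighted
Gram kernel is dominated by the homogeneous kernel, on an interval `[δ, 1]`. -/
lemma setIntegral_mul_normSq_inner_le (hα : α ∈ Ioo (0 : ℝ) 1) (hB : 0 ≤ B)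
    (hK : ContinuousOn K (Ioi 0)) (hw : ContinuousOn w (Ioi 0)) (hw0 : ∀ y, 0 < y → 0 ≤ w y)
    (hbd : ∀ y ∈ Ioc (0 : ℝ) 1, ∀ s ∈ Ioc (0 : ℝ) 1,
      √(w y) * √(w s) * ‖inner ℂ (K y) (K s)‖ ≤ B * homKernel α y s)
    (hδ : 0 < δ) (h : H) :
    ∫ y in Icc δ 1, w y * ‖inner ℂ (K y) h‖ ^ 2 ≤ B * (8 / (1 - α)) * ‖h‖ ^ 2 := by
  have hsub : Icc δ 1 ⊆ Ioi 0 := fun y hy => hδ.trans_le hy.1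
  have hsub' : Icc δ 1 ⊆ Ioc 0 1 := fun y hy => ⟨hδ.trans_le hy.1, hy.2⟩
  set F : ℝ → ℂ := fun y => inner ℂ (K y) h with hF
  have hKc := hK.mono hsub
  have hwc := hw.mono hsub
  have hFc : ContinuousOn F (Icc δ 1) := hKc.inner continuousOn_const
  have hwFc : ContinuousOn (fun y => (w y : ℂ) * F y) (Icc δ 1) :=
    (Complex.continuous_ofReal.comp_continuousOn hwc).mul hFc
  have hac : ContinuousOn (fun y => √(w y) * ‖F y‖) (Icc δ 1) := hwc.sqrt.mul hFc.norm
  have hvi : IntegrableOn (fun y => ((w y : ℂ) * F y) • K y) (Icc δ 1) :=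
    (hwFc.smul hKc).integrableOn_compact isCompact_Icc
  -- With `T h = ⟨K y, h⟩` into the weighted `L²` on `[δ, 1]`, this is `v = T* T h`. Then `⟨h, v⟩ =
  -- ‖T h‖² = A`, and the Schur bound controls `‖v‖²` by a multiple of `A`. Working on `[δ, 1]`
  -- makes every integrand continuous on a compact set.
  set v : H := ∫ y in Icc δ 1, ((w y : ℂ) * F y) • K y with hv
  set A : ℝ := ∫ y in Icc δ 1, w y * ‖F y‖ ^ 2 with hA
  have hA0 : 0 ≤ A := setIntegral_nonneg measurableSet_Icc fun y hy =>
    mul_nonneg (hw0 y (hsub hy)) (sq_nonneg _)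
  have hhv : inner ℂ h v = (A : ℂ) := by
    rw [hv, ← integral_inner hvi, hA, ← integral_complex_ofReal]
    refine integral_congr_ae (Eventually.of_forall fun y => ?_)
    simp only [inner_smul_right]
    rw [← inner_conj_symm h (K y)]
    change (w y : ℂ) * F y * conj (F y) = _
    rw [mul_assoc, Complex.mul_conj, Complex.normSq_eq_norm_sq]
    push_cast
    rfl
  have hvv : ‖v‖ ^ 2 ≤ B * (8 / (1 - α)) * A := by
    have hcpt : IsCompact (Icc δ 1 ×ˢ Icc δ 1 : Set (ℝ × ℝ)) := isCompact_Icc.prod isCompact_Icc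
    have hfst : ∀ {g : ℝ → ℝ}, ContinuousOn g (Icc δ 1) →
        ContinuousOn (fun q : ℝ × ℝ => g q.1) (Icc δ 1 ×ˢ Icc δ 1) := fun hg =>
      hg.comp continuousOn_fst fun q hq => hq.1
    have hsnd : ∀ {g : ℝ → ℝ}, ContinuousOn g (Icc δ 1) →
        ContinuousOn (fun q : ℝ × ℝ => g q.2) (Icc δ 1 ×ˢ Icc δ 1) := fun hg =>
      hg.comp continuousOn_snd fun q hq => hq.2
    have hKK : ContinuousOn (fun q : ℝ × ℝ => inner ℂ (K q.1) (K q.2)) (Icc δ 1 ×ˢ Icc δ 1) :=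
      (hKc.comp continuousOn_fst fun q hq => hq.1).inner
        (hKc.comp continuousOn_snd fun q hq => hq.2)
    set G : ℝ × ℝ → ℝ := fun q => ‖(w q.1 : ℂ) * F q.1‖ * (‖(w q.2 : ℂ) * F q.2‖ *
      ‖inner ℂ (K q.1) (K q.2)‖) with hG
    have hGc : ContinuousOn G (Icc δ 1 ×ˢ Icc δ 1) :=
      (hfst hwFc.norm).mul ((hsnd hwFc.norm).mul hKK.norm)
    have hGi : IntegrableOn G (Icc δ 1 ×ˢ Icc δ 1) := hGc.integrableOn_compact hcpt
    have h1 : ‖v‖ ^ 2 ≤ ∫ q in Icc δ 1 ×ˢ Icc δ 1, G q := by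
      rw [IntegrableOn, ← restrict_prod_restrict] at hGi
      have e1 : ‖v‖ ^ 2 = ‖inner ℂ v v‖ := by
        rw [inner_self_eq_norm_sq_to_K]; simp
      rw [← restrict_prod_restrict, integral_prod _ hGi, e1]
      nth_rewrite 2 [hv]
      rw [← integral_inner hvi]
      refine norm_integral_le_of_norm_le hGi.integral_prod_left
        (Eventually.of_forall fun y => ?_)
      simp only [hG]
      rw [inner_smul_right, norm_mul, integral_const_mul]
      refine mul_le_mul_of_nonneg_left ?_ (norm_nonneg _)
      rw [norm_inner_symm, hv, ← integral_inner hvi]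
      refine (norm_integral_le_integral_norm _).trans (le_of_eq ?_)
      refine integral_congr_ae (Eventually.of_forall fun s => ?_)
      simp only [inner_smul_right, norm_mul]
    have h2 : ∫ q in Icc δ 1 ×ˢ Icc δ 1, G q ≤ ∫ q in Icc δ 1 ×ˢ Icc δ 1,
        B * ((√(w q.1) * ‖F q.1‖) * (√(w q.2) * ‖F q.2‖) * homKernel α q.1 q.2) := by
      refine setIntegral_mono_on hGi ?_ (measurableSet_Icc.prod measurableSet_Icc) fun q hq => ?_
      · refine (continuousOn_const.mul (((hfst hac).mul (hsnd hac)).mul ?_)).integrableOn_compact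
          hcpt
        exact (continuousOn_homKernel α).mono (prod_mono hsub hsub)
      · have hq1 := hw0 _ (hsub hq.1)
        have hq2 := hw0 _ (hsub hq.2)
        have e1 := Real.mul_self_sqrt hq1
        have e2 := Real.mul_self_sqrt hq2
        have hb := hbd _ (hsub' hq.1) _ (hsub' hq.2)
        simp only [hG, norm_mul, Complex.norm_real, Real.norm_eq_abs, abs_of_nonneg hq1,
          abs_of_nonneg hq2]
        calc _ = (√(w q.1) * ‖F q.1‖) * (√(w q.2) * ‖F q.2‖) *
              (√(w q.1) * √(w q.2) * ‖inner ℂ (K q.1) (K q.2)‖) := by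
              nth_rewrite 1 [← e1, ← e2]
              ring
          _ ≤ (√(w q.1) * ‖F q.1‖) * (√(w q.2) * ‖F q.2‖) * (B * homKernel α q.1 q.2) :=
              mul_le_mul_of_nonneg_left hb (by positivity)
          _ = _ := by ring
    have h3 := integral_mul_homKernel_le hα hδ hac
    have h4 : ∫ y in Icc δ 1, (√(w y) * ‖F y‖) ^ 2 = A :=
      setIntegral_congr_fun measurableSet_Icc fun y hy => by
        rw [mul_pow, Real.sq_sqrt (hw0 y (hsub hy))]
    rw [integral_const_mul] at h2
    rw [h4] at h3
    calc _ ≤ _ := h1.trans h2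
      _ ≤ B * (8 / (1 - α) * A) := mul_le_mul_of_nonneg_left h3 hB
      _ = _ := by ring
  have hAle : A ≤ ‖h‖ * ‖v‖ := by
    have := norm_inner_le_norm (𝕜 := ℂ) h v
    rwa [hhv, Complex.norm_real, Real.norm_eq_abs, abs_of_nonneg hA0] at this
  -- From `A² ≤ ‖h‖² ‖v‖²` and the bound on `‖v‖²`, one factor `A` is cancelled, which requires `A >
  -- 0`.
  rcases hA0.eq_or_lt with h0 | h0
  · rw [← h0]
    have : 0 < 1 - α := by linarith [hα.2]
    positivity
  · have h5 : A * A ≤ B * (8 / (1 - α)) * ‖h‖ ^ 2 * A := by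
      calc A * A ≤ (‖h‖ * ‖v‖) * (‖h‖ * ‖v‖) := mul_self_le_mul_self hA0 hAle
        _ = ‖h‖ ^ 2 * ‖v‖ ^ 2 := by ring
        _ ≤ ‖h‖ ^ 2 * (B * (8 / (1 - α)) * A) := by gcongr
        _ = _ := by ring
    exact le_of_mul_le_mul_right h5 h0

end Hilbert

lemma iUnion_Icc_one_div : ⋃ n : ℕ, Icc (1 / ((n : ℝ) + 1)) 1 = Ioc (0 : ℝ) 1 := by
  ext y
  simp only [mem_iUnion, mem_Icc, mem_Ioc]
  constructor
  · rintro ⟨n, h1, h2⟩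
    exact ⟨lt_of_lt_of_le (by positivity) h1, h2⟩
  · rintro ⟨h1, h2⟩
    obtain ⟨n, hn⟩ := exists_nat_one_div_lt h1
    exact ⟨n, hn.le, h2⟩

/-- Passage to the whole interval `(0, 1)`. -/
lemma lintegral_Ioo_le_of_integral_Icc_le {g : ℝ → ℝ} {S : ℝ} (hg : ContinuousOn g (Ioi 0))
    (hg0 : ∀ y, 0 < y → 0 ≤ g y) (hS : ∀ δ, 0 < δ → ∫ y in Icc δ 1, g y ≤ S) :
    ∫⁻ y in Ioo 0 1, ENNReal.ofReal (g y) ≤ ENNReal.ofReal S := by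
  refine (lintegral_mono_set Ioo_subset_Ioc_self).trans ?_
  rw [← iUnion_Icc_one_div, setLIntegral_iUnion_of_directed]
  · refine iSup_le fun n => ?_
    have hn : (0 : ℝ) < 1 / ((n : ℝ) + 1) := by positivity
    have hsub : Icc (1 / ((n : ℝ) + 1)) 1 ⊆ Ioi 0 := fun y hy => hn.trans_le hy.1
    rw [← ofReal_integral_eq_lintegral_ofReal
      ((hg.mono hsub).integrableOn_compact isCompact_Icc)
      ((ae_restrict_iff' measurableSet_Icc).2 (Eventually.of_forall fun y hy => hg0 y (hsub hy)))]
    exact ENNReal.ofReal_le_ofReal (hS _ hn)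
  · refine Monotone.directed_le (f := fun n : ℕ => Icc (1 / ((n : ℝ) + 1)) 1) fun i j hij => ?_
    exact Icc_subset_Icc_left (one_div_le_one_div_of_le (by positivity) (by simpa using hij))

variable {m : ℂ → ℂ}

section Space

variable [Fact (kernel m).PosSemidef]

/-- The point evaluation vectors of `ℋ(m)` along the positive imaginary axis. -/
def axisVector (m : ℂ → ℂ) [Fact (kernel m).PosSemidef] (y : ℝ) : space m :=
  open Classical in
  if hy : y ≠ 0 then
    RKHS.kerFun (space m) (⟨(y : ℂ) * Complex.I, by simpa using hy⟩ : NonReal) (1 : ℂ)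
  else 0

/-- The reproducing property; at `y = 0` both sides take the default value `0`. -/
lemma inner_axisVector (h : space m) (y : ℝ) :
    inner ℂ (axisVector m y) h = onImaginaryAxis h y := by
  unfold axisVector onImaginaryAxis
  split_ifs with hy
  · rw [RKHS.kerFun_inner]; simp
  · simp

lemma inner_axisVector_axisVector {y s : ℝ} (hy : y ≠ 0) (hs : s ≠ 0) :
    inner ℂ (axisVector m y) (axisVector m s) =
      kernelFun m (y * Complex.I) (s * Complex.I) := by
  rw [inner_axisVector, onImaginaryAxis, dif_pos hy, axisVector, dif_pos hs, RKHS.kerFun_apply,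
    RKHS.OfKernel.kernel_ofKernel]
  simp [kernel]

/-- `‖K_s - K_y‖²` expands into four kernel values on the imaginary axis, which are continuous in
`s` and cancel at `s = y`. -/
lemma continuousOn_axisVector (hm : IsNevanlinna m) : ContinuousOn (axisVector m) (Ioi 0) := by
  intro y hy
  have hy0 : 0 < y := hy
  have hc := hm.continuousOn_imaginary
  have hcont : ContinuousOn (fun s : ℝ =>
      kernelFun m (s * Complex.I) (s * Complex.I) - kernelFun m (s * Complex.I) (y * Complex.I) -
        kernelFun m (y * Complex.I) (s * Complex.I) +
        kernelFun m (y * Complex.I) (y * Complex.I)) (Ioi 0) := by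
    have hne : ∀ {a b : ℝ}, 0 < a → 0 < b → ((a + b : ℝ) : ℂ) * Complex.I ≠ 0 := fun ha hb =>
      mul_ne_zero (by exact_mod_cast (add_pos ha hb).ne') Complex.I_ne_zero
    have hk : ∀ {a b : ℝ → ℝ}, ContinuousOn a (Ioi 0) → ContinuousOn b (Ioi 0) →
        (∀ s, 0 < s → 0 < a s) → (∀ s, 0 < s → 0 < b s) →
        ContinuousOn (fun s : ℝ => kernelFun m (a s * Complex.I) (b s * Complex.I)) (Ioi 0) := by
      intro a b ha hb ha0 hb0
      have : ContinuousOn (fun s : ℝ => (m (a s * Complex.I) - conj (m (b s * Complex.I))) /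
          (((a s + b s : ℝ) : ℂ) * Complex.I)) (Ioi 0) := by
        refine ContinuousOn.div (ContinuousOn.sub (hc.comp ha fun s hs => ha0 s hs)
          (Complex.continuous_conj.comp_continuousOn (hc.comp hb fun s hs => hb0 s hs)))
          ((Complex.continuous_ofReal.comp_continuousOn (ha.add hb)).mul continuousOn_const)
          fun s hs => hne (ha0 s hs) (hb0 s hs)
      exact this.congr fun s hs => kernelFun_imaginary m (ha0 s hs) (hb0 s hs)
    have hid : ContinuousOn (fun s : ℝ => s) (Ioi 0) := continuousOn_id
    have hcst : ContinuousOn (fun _ : ℝ => y) (Ioi 0) := continuousOn_const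
    exact (((hk hid hid (fun s hs => hs) fun s hs => hs).sub
      (hk hid hcst (fun s hs => hs) fun _ _ => hy0)).sub
      (hk hcst hid (fun _ _ => hy0) fun s hs => hs)).add
      (hk hcst hcst (fun _ _ => hy0) fun _ _ => hy0)
  have hlim := (hcont.norm.sqrt y hy)
  rw [ContinuousWithinAt] at hlim
  rw [ContinuousWithinAt, tendsto_iff_norm_sub_tendsto_zero]
  have h0 : √‖kernelFun m (y * Complex.I) (y * Complex.I) -
      kernelFun m (y * Complex.I) (y * Complex.I) - kernelFun m (y * Complex.I) (y * Complex.I) +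
        kernelFun m (y * Complex.I) (y * Complex.I)‖ = 0 := by simp
  rw [h0] at hlim
  refine hlim.congr' ?_
  filter_upwards [self_mem_nhdsWithin] with s hs
  have hs0 : s ≠ 0 := ne_of_gt hs
  rw [← inner_axisVector_axisVector hs0 hs0, ← inner_axisVector_axisVector hs0 hy0.ne',
    ← inner_axisVector_axisVector hy0.ne' hs0, ← inner_axisVector_axisVector hy0.ne' hy0.ne',
    ← inner_sub_sub_self, inner_self_eq_norm_sq_to_K]
  simp [Real.sqrt_sq]

lemma continuousOn_onImaginaryAxis (hm : IsNevanlinna m) (h : space m) :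
    ContinuousOn (onImaginaryAxis h) (Ioi 0) :=
  ((continuousOn_axisVector hm).inner continuousOn_const).congr fun y _ =>
    (inner_axisVector h y).symm

end Space

lemma IsNevanlinna.continuousOn_weight (hm : IsNevanlinna m)
    (hpos : ∀ z : ℂ, 0 < z.im → 0 < (m z).im) : ContinuousOn (weight m) (Ioi 0) :=
  continuousOn_const.div (Complex.continuous_im.comp_continuousOn hm.continuousOn_imaginary)
    fun _ hy => (hpos _ (mul_I_im_pos hy)).ne'

lemma weight_nonneg (hpos : ∀ z : ℂ, 0 < z.im → 0 < (m z).im) {y : ℝ} (hy : 0 < y) :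
    0 ≤ weight m y :=
  one_div_nonneg.2 (hpos _ (mul_I_im_pos hy)).le

/-- Every function of the class `𝒜₀` has the `B₀`-property. -/
theorem hasB0Property_of_mem_asymptoticClassZero (hm : m ∈ AsymptoticClassZero) :
    HasB0Property m := by
  have hN : IsNevanlinna m := hm.1
  have hpos := (exists_bounds_of_mem_asymptoticClassZero hm).1
  obtain ⟨α, hα, B, hB, hbd⟩ := exists_kernelFun_le_homKernel hm
  refine ⟨hN.posSemidef_kernel, ?_⟩
  have : Fact (kernel m).PosSemidef := ⟨hN.posSemidef_kernel⟩
  set S := B * (8 / (1 - α)) with hS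
  have hS0 : 0 ≤ S := by
    have : 0 < 1 - α := by linarith [hα.2]
    positivity
  -- `S` bounds the squared norm, uniformly in `δ`; hence the square root.
  refine ⟨Real.toNNReal √S, fun h => ?_⟩
  have hw := hN.continuousOn_weight hpos
  have hF := continuousOn_onImaginaryAxis hN h
  have hsub : Ioo (0 : ℝ) 1 ⊆ Ioi 0 := Ioo_subset_Ioi_self
  have hFm : AEStronglyMeasurable (onImaginaryAxis h) (volume.restrict (Ioo 0 1)) :=
    (hF.mono hsub).aestronglyMeasurable measurableSet_Ioo
  have hle : eLpNorm (onImaginaryAxis h) 2 (weightMeasureZero m) ≤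
      (Real.toNNReal √S : ℝ≥0∞) * ‖h‖ₑ := by
    have hlin : ∫⁻ y, ‖onImaginaryAxis h y‖ₑ ^ (2 : ℝ) ∂weightMeasureZero m ≤
        ENNReal.ofReal (S * ‖h‖ ^ 2) := by
      rw [weightMeasureZero, lintegral_withDensity_eq_lintegral_mul₀
        ((hw.mono hsub).aemeasurable measurableSet_Ioo).ennreal_ofReal
        (hFm.enorm.pow_const _)]
      refine le_trans (le_of_eq ?_) (lintegral_Ioo_le_of_integral_Icc_le
        (g := fun y => weight m y * ‖onImaginaryAxis h y‖ ^ 2) (hw.mul (hF.norm.pow 2))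
        (fun y hy => mul_nonneg (weight_nonneg hpos hy) (sq_nonneg _)) fun δ hδ => ?_)
      · refine setLIntegral_congr_fun measurableSet_Ioo fun y hy => ?_
        simp only [Pi.mul_apply]
        rw [ENNReal.ofReal_mul (weight_nonneg hpos hy.1), ENNReal.ofReal_pow (norm_nonneg _),
          ofReal_norm]
        norm_cast
      · have := setIntegral_mul_normSq_inner_le (H := space m) (K := axisVector m) hα hB.le
          (continuousOn_axisVector hN) hw (fun y hy => weight_nonneg hpos hy)
          (fun y hy s hs => by
            rw [inner_axisVector_axisVector hy.1.ne' hs.1.ne']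
            exact hbd y hy s hs) hδ h
        simpa only [inner_axisVector] using this
    rw [eLpNorm_eq_lintegral_rpow_enorm_toReal two_ne_zero ENNReal.ofNat_ne_top,
      ENNReal.toReal_ofNat]
    calc _ ≤ ENNReal.ofReal (S * ‖h‖ ^ 2) ^ (1 / (2 : ℝ)) :=
          ENNReal.rpow_le_rpow hlin (by norm_num)
      _ = ENNReal.ofReal (√S * ‖h‖) := by
          rw [ENNReal.ofReal_rpow_of_nonneg (by positivity) (by norm_num), ← Real.sqrt_eq_rpow,
            Real.sqrt_mul hS0, Real.sqrt_sq (norm_nonneg _)]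
      _ = _ := by
          rw [ENNReal.ofReal_mul (Real.sqrt_nonneg _), ofReal_norm]
          rfl
  -- Measurability passes from Lebesgue measure to the weighted measure by absolute continuity.
  refine ⟨⟨hFm.mono_ac (withDensity_absolutelyContinuous _ _), hle.trans_lt ?_⟩, hle⟩
  exact ENNReal.mul_lt_top ENNReal.coe_lt_top enorm_lt_top

end Embedding

end Nevanlinna

end

theorem mainTheorem6 (m : ℂ → ℂ) (hm : m ∈ Nevanlinna.AsymptoticClassZero) :
    Nevanlinna.HasB0Property m :=
  Nevanlinna.hasB0Property_of_mem_asymptoticClassZero hm
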